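/- Let $B:\mathbb R^2\to\mathbb R$ satisfy $B\in L^p_{\rm loc}(\mathbb R^2)$ for some $p>2$ and $|B(x)|=\mathcal O(|x|^{-\tau})$ as $|x|\to\infty$ for some $\tau>2$. Put $$\alpha=\frac1{2\pi}\int_{\mathbb R^2}B\,dx,\qquad \mu_\alpha=\min_{m\in\mathbb Z}|m-\alpha|,\qquad h(x)=-\frac1{2\pi}\int_{\mathbb R^2}B(y)\log|x-y|\,dy,\qquad A_h=(\partial_{x_2}h,-\partial_{x_1}h).$$ For $\rho>0$ let $g_+(\rho;r)=1$ if $r\le\rho$ and $g_+(\rho;r)=\rho^{-\alpha}r^{\alpha}$ if $r>\rho$, let $g_-=1/g_+$, and define $$k_-(\rho)=\inf_{x\in\mathbb R^2}\frac{e^{h(x)}}{g_-(\rho;|x|)},\qquad K_-(\rho)=\sup_{x\in\mathbb R^2}\frac{e^{h(x)}}{g_-(\rho;|x|)},\qquad \beta_-(B;\rho)=\Big(\frac{k_-(\rho)}{K_-(\rho)}\Big)^2 .$$ For $u\in H^1(\mathbb R^2)$ (complex valued) let $$Q_-[u]=\int_{\mathbb R^2}\big(|(i\nabla+A_h)u|^2-B|u|^2\big)\,dx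 .$$ **Theorem.** Suppose that $\alpha\le 0$. Then for all $u\in H^1(\mathbb R^2)$ and all $\rho>0$ the integrals below and the one defining $Q_-[u]$ converge absolutely, and $$Q_-[u]\ \ge\ \beta_-(B;\rho)\,\mu_\alpha^2\int_{\mathbb R^2}\frac{|u|^2}{\rho^2+|x|^2}\,dx\qquad\text{if }\alpha\notin\mathbb Z,$$ $$Q_-[u]\ \ge\ \beta_-(B;\rho)\,\frac{|\alpha|}{4|\alpha|+\pi}\int_{\mathbb R^2}\frac{|u|^2}{\rho^2+|x|^2\big(1+\log^2(|x|/\rho)\big)}\,dx\qquad\text{if }\alpha\in\mathbb Z.$$ -/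

import Mathlib

open MeasureTheory
open scoped ENNReal ContDiff

noncomputable section

namespace PauliHardy

/-- The Euclidean plane `ℝ²`, with its Euclidean norm and Lebesgue measure. -/
abbrev Plane : Type := EuclideanSpace ℝ (Fin 2)

/-- The `j`-th standard unit vector of the plane. -/
def unitVec (j : Fin 2) : Plane := EuclideanSpace.single j (1 : ℝ)

/-- The classical `j`-th partial derivative of a real function on the plane. -/
def partialD (j : Fin 2) (f : Plane → ℝ) (x : Plane) : ℝ := fderiv ℝ f x (unitVec j)

/-! ### The Sobolev space of order one -/

/-- `w` lies in `L²` and is the `j`-th partial derivative of `u` in the sense of distributions: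
`∫ (∂_j φ) u = - ∫ φ w` for all test functions `φ`. -/
def IsL2WeakPartial (j : Fin 2) (u w : Plane → ℂ) : Prop :=
  MemLp w 2 volume ∧
    ∀ φ : Plane → ℝ, ContDiff ℝ ∞ φ → HasCompactSupport φ →
      ∫ x, (partialD j φ x : ℂ) * u x = -∫ x, (φ x : ℂ) * w x

/-- `u ∈ H¹(ℝ²)`: the function and its first weak partial derivatives lie in `L²`. -/
def MemH1 (u : Plane → ℂ) : Prop :=
  MemLp u 2 volume ∧ ∀ j : Fin 2, ∃ w : Plane → ℂ, IsL2WeakPartial j u w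

open Classical in
/-- The `j`-th weak partial derivative of `u` (unique up to null sets when `u ∈ H¹`). -/
def weakPartial (j : Fin 2) (u : Plane → ℂ) : Plane → ℂ :=
  if hw : ∃ w : Plane → ℂ, IsL2WeakPartial j u w then hw.choose else 0

/-! ### The magnetic field, its flux and its vector potential -/

/-- The standing assumption on the field: `B ∈ L^p_loc(ℝ²)` for some `p > 2`, and
`|B(x)| = O(|x|^{-τ})` at infinity for some `τ > 2`. -/
def AdmissibleField (B : Plane → ℝ) : Prop :=
  (∃ p : ℝ≥0∞, 2 < p ∧ ∀ K : Set Plane, IsCompact K → MemLp B p (volume.restrict K)) ∧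
  (∃ τ : ℝ, 2 < τ ∧ ∃ C R : ℝ, ∀ᵐ x : Plane, R ≤ ‖x‖ → |B x| ≤ C * ‖x‖ ^ (-τ))

/-- The normalized flux `α = (2π)⁻¹ ∫ B`. -/
def flux (B : Plane → ℝ) : ℝ := 1 / (2 * Real.pi) * ∫ x, B x

/-- The distance `μ_α = min_{m ∈ ℤ} |m - α|` of `α` from the integers. -/
def distInt (α : ℝ) : ℝ := ⨅ m : ℤ, |(m : ℝ) - α|

/-- The scalar potential `h(x) = -(2π)⁻¹ ∫ B(y) log |x - y| dy`. -/
def scalarPot (B : Plane → ℝ) (x : Plane) : ℝ :=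
  -(1 / (2 * Real.pi)) * ∫ y, B y * Real.log ‖x - y‖

/-- The vector potential `A_h = (∂₂ h, -∂₁ h)`. -/
def vectorPot (B : Plane → ℝ) (x : Plane) : Fin 2 → ℝ :=
  ![partialD 1 (scalarPot B) x, -partialD 0 (scalarPot B) x]

/-! ### The constant `β₋(B; ρ)` -/

/-- `g₊(ρ; r)`: it is `1` for `r ≤ ρ` and `ρ^{-α} r^α` for `r > ρ`. -/
def gPlus (α ρ r : ℝ) : ℝ := if r ≤ ρ then 1 else ρ ^ (-α) * r ^ α

/-- `g₋ = 1 / g₊`. -/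
def gMinus (α ρ r : ℝ) : ℝ := 1 / gPlus α ρ r

/-- `k₋(ρ) = inf_x e^{h(x)} / g₋(ρ; |x|)`. -/
def kMinus (B : Plane → ℝ) (ρ : ℝ) : ℝ :=
  ⨅ x : Plane, Real.exp (scalarPot B x) / gMinus (flux B) ρ ‖x‖

/-- `K₋(ρ) = sup_x e^{h(x)} / g₋(ρ; |x|)`. -/
def capKMinus (B : Plane → ℝ) (ρ : ℝ) : ℝ :=
  ⨆ x : Plane, Real.exp (scalarPot B x) / gMinus (flux B) ρ ‖x‖

/-- `β₋(B; ρ) = (k₋(ρ) / K₋(ρ))²`. -/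
def betaMinus (B : Plane → ℝ) (ρ : ℝ) : ℝ := (kMinus B ρ / capKMinus B ρ) ^ 2

/-! ### The spin-down quadratic form -/

/-- The density `|(i∇ + A_h) u|² - B |u|²`. -/
def densityMinus (B : Plane → ℝ) (u : Plane → ℂ) (x : Plane) : ℝ :=
  (∑ j : Fin 2, ‖Complex.I * weakPartial j u x + (vectorPot B x j : ℂ) * u x‖ ^ 2)
    - B x * ‖u x‖ ^ 2

/-- `Q₋[u] = ∫ (|(i∇ + A_h) u|² - B |u|²) dx`. -/
def formMinus (B : Plane → ℝ) (u : Plane → ℂ) : ℝ := ∫ x, densityMinus B u x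

end PauliHardy

end

/-!
The potential `h` solves `-Δh = B`, so on test functions
`Q₋[φ] = ∫ |(D₀ + i D₁) φ|²` with `D = i∇ + A_h`, and `D₀ + i D₁` is conjugate to the
Cauchy–Riemann operator: `(D₀ + i D₁) φ = i e^h (∂₀ + i ∂₁)(e^{-h} φ)`. Since `e^h` is comparable
to `g₋`, up to the factor `β₋` everything reduces to a Hardy inequality for `∂₀ + i ∂₁` in the
radial weight `g₋²`. In polar coordinates this inequality decouples into the Fourier modes on
circles; for each mode one completes a square with a radial drift, constant when `α ∉ ℤ` and
logarithmic when `α ∈ ℤ`.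

The passage to `H¹` uses that `∇h` is bounded, both for `B` and for `|B|`: testing
`-Δh_{|B|} = |B|` against `|φ|²` bounds `∫ |B| |φ|²` by the `H¹` norm.
-/

noncomputable section

namespace PauliHardy

open Set Filter Topology Real

section Polar

theorem hasDerivAt_intervalIntegral_of_continuous {E : Type*} [NormedAddCommGroup E]
    [NormedSpace ℝ E] {F F' : ℝ → ℝ → E} {a b : ℝ}
    (hF : Continuous (Function.uncurry F)) (hF' : Continuous (Function.uncurry F'))
    (h : ∀ r t, HasDerivAt (fun s => F s t) (F' r t) r) (r : ℝ) :
    HasDerivAt (fun s => ∫ t in a..b, F s t) (∫ t in a..b, F' r t) r := by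
  have hK : IsCompact (Metric.closedBall r 1 ×ˢ uIcc a b) :=
    (isCompact_closedBall r 1).prod isCompact_uIcc
  obtain ⟨C, hC⟩ := hK.exists_bound_of_continuousOn hF'.continuousOn
  exact (intervalIntegral.hasDerivAt_integral_of_dominated_loc_of_deriv_le
    (bound := fun _ => C) (Metric.closedBall_mem_nhds r one_pos)
    (.of_forall fun s => (hF.comp (.prodMk_right s)).aestronglyMeasurable)
    ((hF.comp (.prodMk_right r)).intervalIntegrable _ _)
    (hF'.comp (.prodMk_right r)).aestronglyMeasurable
    (.of_forall fun t ht s hs => hC (s, t) ⟨hs, uIoc_subset_uIcc ht⟩)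
    intervalIntegrable_const (.of_forall fun t _ s _ => h s t)).2

/-- The point of the plane with polar coordinates `p = (r, t)`; `r` may be any real number. -/
def polarPoint (p : ℝ × ℝ) : Plane := !₂[p.1 * cos p.2, p.1 * sin p.2]

/-- The unit vector `e_r` of polar coordinates. -/
def radialVec (t : ℝ) : Plane := !₂[cos t, sin t]

/-- The unit vector `e_θ` of polar coordinates. -/
def angularVec (t : ℝ) : Plane := !₂[-sin t, cos t]

theorem radialVec_eq (t : ℝ) : radialVec t = cos t • unitVec 0 + sin t • unitVec 1 := by
  ext i
  fin_cases i <;> simp [radialVec, unitVec]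

theorem angularVec_eq (t : ℝ) : angularVec t = -sin t • unitVec 0 + cos t • unitVec 1 := by
  ext i
  fin_cases i <;> simp [angularVec, unitVec]

theorem polarPoint_eq_smul (p : ℝ × ℝ) : polarPoint p = p.1 • radialVec p.2 := by
  ext i
  fin_cases i <;> simp [polarPoint, radialVec]

theorem norm_polarPoint (p : ℝ × ℝ) : ‖polarPoint p‖ = |p.1| := by
  rw [polarPoint_eq_smul, norm_smul, Real.norm_eq_abs]
  simp [radialVec, EuclideanSpace.norm_eq, Fin.sum_univ_two]

@[fun_prop]
theorem continuous_radialVec : Continuous radialVec := by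
  unfold radialVec
  fun_prop

@[fun_prop]
theorem continuous_angularVec : Continuous angularVec := by
  unfold angularVec
  fun_prop

@[fun_prop]
theorem continuous_polarPoint : Continuous polarPoint := by
  unfold polarPoint
  fun_prop

theorem hasDerivAt_polarPoint_fst (r t : ℝ) :
    HasDerivAt (fun s => polarPoint (s, t)) (radialVec t) r := by
  simp only [polarPoint_eq_smul]
  simpa using (hasDerivAt_id r).smul_const (radialVec t)

theorem hasDerivAt_polarPoint_snd (r t : ℝ) :
    HasDerivAt (fun s => polarPoint (r, s)) (r • angularVec t) t := by
  simp only [polarPoint_eq_smul, radialVec_eq, angularVec_eq]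
  exact (((hasDerivAt_cos t).smul_const (unitVec 0)).add
    ((hasDerivAt_sin t).smul_const (unitVec 1))).const_smul r

theorem hasDerivAt_comp_polarPoint_fst {E : Type*} [NormedAddCommGroup E] [NormedSpace ℝ E]
    {v : Plane → E} (hv : ContDiff ℝ 1 v) (r t : ℝ) :
    HasDerivAt (fun s => v (polarPoint (s, t))) (fderiv ℝ v (polarPoint (r, t)) (radialVec t)) r :=
  (hv.differentiable one_ne_zero _).hasFDerivAt.comp_hasDerivAt r (hasDerivAt_polarPoint_fst r t)

@[fun_prop]
theorem continuous_fderiv_polarPoint_apply {E : Type*} [NormedAddCommGroup E] [NormedSpace ℝ E]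
    {v : Plane → E} (hv : ContDiff ℝ 1 v) {e : ℝ → Plane} (he : Continuous e) :
    Continuous fun p : ℝ × ℝ => fderiv ℝ v (polarPoint p) (e p.2) :=
  ((hv.continuous_fderiv one_ne_zero).comp continuous_polarPoint).clm_apply
    (he.comp continuous_snd)

theorem integral_eq_integral_polarPoint (f : Plane → ℝ) :
    ∫ x, f x = ∫ p in polarCoord.target, p.1 * f (polarPoint p) := by
  have e₁ := EuclideanSpace.volume_preserving_symm_measurableEquiv_toLp (Fin 2)
  have e₂ := volume_preserving_finTwoArrow ℝ
  rw [← (e₁.symm _).integral_comp (MeasurableEquiv.measurableEmbedding _),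
    ← (e₂.symm _).integral_comp (MeasurableEquiv.measurableEmbedding _),
    ← integral_comp_polarCoord_symm]
  rfl

-- `F = r f` rather than `f` is continuous, so that a singularity `1 / r` at the origin is allowed.
theorem integral_eq_intervalIntegral_polar {f : Plane → ℝ} {F : ℝ → ℝ → ℝ} {R : ℝ} (hR : 0 ≤ R)
    (hF : ContinuousOn (Function.uncurry F) (Icc 0 R ×ˢ univ))
    (hfF : ∀ r t, 0 < r → r * f (polarPoint (r, t)) = F r t)
    (hsupp : ∀ r t, R < r → F r t = 0) :
    ∫ x, f x = ∫ r in (0 : ℝ)..R, ∫ t in (-π)..π, F r t := by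
  have hpi : -π ≤ π := by linarith [pi_pos]
  have hint : IntegrableOn (Function.uncurry F) (Ioc (0 : ℝ) R ×ˢ Ioo (-π) π) :=
    ((hF.mono (prod_mono Subset.rfl (subset_univ _))).integrableOn_compact
      (isCompact_Icc.prod (isCompact_Icc (a := -π) (b := π)))).mono_set
      (prod_mono Ioc_subset_Icc_self Ioo_subset_Icc_self)
  calc ∫ x, f x
      = ∫ p in Ioi (0 : ℝ) ×ˢ Ioo (-π) π, Function.uncurry F p := by
        rw [integral_eq_integral_polarPoint]
        exact setIntegral_congr_fun polarCoord.open_target.measurableSet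
          fun p hp => hfF p.1 p.2 hp.1
    _ = ∫ p in Ioc (0 : ℝ) R ×ˢ Ioo (-π) π, Function.uncurry F p := by
        refine setIntegral_eq_of_subset_of_forall_sdiff_eq_zero
          (measurableSet_Ioi.prod measurableSet_Ioo)
          (prod_mono Ioc_subset_Ioi_self Subset.rfl) ?_
        rintro ⟨r, t⟩ ⟨⟨hr, ht⟩, h⟩
        exact hsupp r t (not_le.1 fun hle => h ⟨⟨hr, hle⟩, ht⟩)
    _ = ∫ r in (0 : ℝ)..R, ∫ t in (-π)..π, F r t := by
        rw [Measure.volume_eq_prod, setIntegral_prod _ hint, intervalIntegral.integral_of_le hR]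
        refine setIntegral_congr_fun measurableSet_Ioc fun r _ => ?_
        simp only [intervalIntegral.integral_of_le hpi, integral_Ioc_eq_integral_Ioo]
        rfl

end Polar

section CircleCoefficients

/-- The classical `j`-th partial derivative of a complex function on the plane, the counterpart of
`partialD`. -/
def partialC (j : Fin 2) (v : Plane → ℂ) (x : Plane) : ℂ := fderiv ℝ v x (unitVec j)

/-- The Cauchy–Riemann operator `∂₀ + i ∂₁`, that is `2 ∂̄`. -/
def cauchyRiemann (v : Plane → ℂ) (x : Plane) : ℂ := partialC 0 v x + Complex.I * partialC 1 v x

/-- The `m`-th Fourier coefficient of `v` on the circle of radius `r` about the origin. -/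
def circleCoeff (v : Plane → ℂ) (m : ℤ) (r : ℝ) : ℂ :=
  (2 * π)⁻¹ • ∫ t in (-π)..π, Complex.exp (-(m * t * Complex.I)) * v (polarPoint (r, t))

theorem continuous_exp_neg_mul_I (m : ℤ) :
    Continuous fun t : ℝ => Complex.exp (-(m * t * Complex.I)) := by
  fun_prop

theorem circleCoeff_eq_fourierCoeffOn (v : Plane → ℂ) (m : ℤ) (r : ℝ) :
    circleCoeff v m r
      = fourierCoeffOn (neg_lt_self pi_pos) (fun t => v (polarPoint (r, t))) m := by
  rw [fourierCoeffOn_eq_integral, circleCoeff, sub_neg_eq_add, ← two_mul, one_div]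
  congr 1
  refine intervalIntegral.integral_congr fun t _ => ?_
  simp only [fourier_coe_apply, smul_eq_mul]
  congr 2
  have : (π : ℂ) ≠ 0 := Complex.ofReal_ne_zero.2 pi_ne_zero
  push_cast
  field_simp

variable {v : Plane → ℂ}

theorem continuous_circleCoeff (hv : Continuous v) (m : ℤ) : Continuous (circleCoeff v m) := by
  have h : Continuous fun r => ∫ t in (-π)..π,
      Complex.exp (-(m * t * Complex.I)) * v (polarPoint (r, t)) :=
    intervalIntegral.continuous_parametric_intervalIntegral_of_continuous'
      (((continuous_exp_neg_mul_I m).comp continuous_snd).mul (hv.comp continuous_polarPoint)) _ _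
  exact h.const_smul (2 * π)⁻¹

theorem hasSum_circleCoeff_sq (hv : Continuous v) (r : ℝ) :
    HasSum (fun m => 2 * π * ‖circleCoeff v m r‖ ^ 2)
      (∫ t in (-π)..π, ‖v (polarPoint (r, t))‖ ^ 2) := by
  have hc : Continuous fun t => v (polarPoint (r, t)) :=
    hv.comp (continuous_polarPoint.comp (.prodMk_right r))
  have hL2 : MemLp (fun t => v (polarPoint (r, t))) 2 (volume.restrict (Ioc (-π) π)) :=
    (memLp_two_iff_integrable_sq_norm hc.aestronglyMeasurable).2
      ((hc.norm.pow 2).integrableOn_Icc.mono_set Ioc_subset_Icc_self)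
  have h := (hasSum_sq_fourierCoeffOn (neg_lt_self pi_pos) hL2).mul_left (2 * π)
  simp only [← circleCoeff_eq_fourierCoeffOn, sub_neg_eq_add, ← two_mul, smul_eq_mul] at h
  rwa [mul_inv_cancel_left₀ two_pi_pos.ne'] at h

theorem hasSum_intervalIntegral_circleCoeff_sq (hv : Continuous v) {R : ℝ} {W : ℝ → ℝ}
    (hW : Continuous W) (hR : 0 ≤ R) (hsupp : ∀ x, R < ‖x‖ → v x = 0) :
    HasSum (fun m => 2 * π * ∫ r in (0 : ℝ)..R, r * (W r * ‖circleCoeff v m r‖ ^ 2))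
      (∫ x, W ‖x‖ * ‖v x‖ ^ 2) := by
  set S : ℝ → ℝ := fun r => ∫ t in (-π)..π, ‖v (polarPoint (r, t))‖ ^ 2
  have hvp : Continuous fun p : ℝ × ℝ => ‖v (polarPoint p)‖ ^ 2 :=
    (hv.comp continuous_polarPoint).norm.pow 2
  have hS : Continuous S :=
    intervalIntegral.continuous_parametric_intervalIntegral_of_continuous' hvp _ _
  have hpolar : ∫ x, W ‖x‖ * ‖v x‖ ^ 2 = ∫ r in (0 : ℝ)..R, r * W r * S r := by
    rw [integral_eq_intervalIntegral_polar hR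
      (F := fun r t => r * W r * ‖v (polarPoint (r, t))‖ ^ 2)]
    · simp only [S, intervalIntegral.integral_const_mul]
    · exact ((continuous_fst.mul (hW.comp continuous_fst)).mul hvp).continuousOn
    · intro r t hr
      rw [norm_polarPoint, abs_of_pos hr, mul_assoc]
    · intro r t hr
      rw [hsupp _ (by rwa [norm_polarPoint, abs_of_pos (hR.trans_lt hr)])]
      simp
  have hsum : ∀ b r : ℝ, HasSum (fun m => b * (2 * π * ‖circleCoeff v m r‖ ^ 2)) (b * S r) :=
    fun b r => (hasSum_circleCoeff_sq hv r).mul_left b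
  have hdom := intervalIntegral.hasSum_integral_of_dominated_convergence (μ := volume)
    (a := 0) (b := R) (F := fun m r => r * W r * (2 * π * ‖circleCoeff v m r‖ ^ 2))
    (bound := fun m r => |r * W r| * (2 * π * ‖circleCoeff v m r‖ ^ 2))
    (fun m => by
      have := continuous_circleCoeff hv m
      exact Continuous.aestronglyMeasurable (by fun_prop))
    (fun m => .of_forall fun r _ => by
      rw [norm_mul, Real.norm_eq_abs, Real.norm_of_nonneg (by positivity)])
    (.of_forall fun r _ => (hsum _ r).summable)
    (by
      simp only [fun r => (hsum |r * W r| r).tsum_eq]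
      exact Continuous.intervalIntegrable (by fun_prop) _ _)
    (.of_forall fun r _ => hsum _ r)
  rw [hpolar]
  refine hdom.congr_fun fun m => ?_
  rw [← intervalIntegral.integral_const_mul]
  exact intervalIntegral.integral_congr fun r _ => by ring

theorem hasDerivAt_comp_polarPoint_snd (hv : ContDiff ℝ 1 v) (r t : ℝ) :
    HasDerivAt (fun s => v (polarPoint (r, s)))
      (r * fderiv ℝ v (polarPoint (r, t)) (angularVec t)) t := by
  refine ((hv.differentiable one_ne_zero _).hasFDerivAt.comp_hasDerivAt t
    (hasDerivAt_polarPoint_snd r t)).congr_deriv ?_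
  rw [map_smul, Complex.real_smul]

theorem fderiv_radialVec_add_I_mul (v : Plane → ℂ) (x : Plane) (t : ℝ) :
    fderiv ℝ v x (radialVec t) + Complex.I * fderiv ℝ v x (angularVec t)
      = Complex.exp (-(t * Complex.I)) * cauchyRiemann v x := by
  rw [radialVec_eq, angularVec_eq, ← neg_mul, Complex.exp_mul_I, Complex.cos_neg, Complex.sin_neg,
    cauchyRiemann, partialC, partialC]
  simp only [map_add, map_smul, Complex.real_smul]
  push_cast
  linear_combination (Complex.sin t * fderiv ℝ v x (unitVec 1)) * Complex.I_sq

theorem hasDerivAt_circleCoeff (hv : ContDiff ℝ 1 v) (m : ℤ) (r : ℝ) :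
    HasDerivAt (circleCoeff v m) ((2 * π)⁻¹ • ∫ t in (-π)..π,
      Complex.exp (-(m * t * Complex.I)) * fderiv ℝ v (polarPoint (r, t)) (radialVec t)) r := by
  have he : Continuous fun p : ℝ × ℝ => Complex.exp (-(m * p.2 * Complex.I)) :=
    (continuous_exp_neg_mul_I m).comp continuous_snd
  exact (hasDerivAt_intervalIntegral_of_continuous
    (F := fun r t => Complex.exp (-(m * t * Complex.I)) * v (polarPoint (r, t)))
    (F' := fun r t =>
      Complex.exp (-(m * t * Complex.I)) * fderiv ℝ v (polarPoint (r, t)) (radialVec t))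
    (he.mul (hv.continuous.comp continuous_polarPoint))
    (he.mul (continuous_fderiv_polarPoint_apply hv continuous_radialVec))
    (fun s t => (hasDerivAt_comp_polarPoint_fst hv s t).const_mul _) r).const_smul (2 * π)⁻¹

theorem intervalIntegral_exp_mul_fderiv_angularVec (hv : ContDiff ℝ 1 v) (m : ℤ) (r : ℝ) :
    r * ∫ t in (-π)..π,
        Complex.exp (-(m * t * Complex.I)) * fderiv ℝ v (polarPoint (r, t)) (angularVec t)
      = m * Complex.I * ∫ t in (-π)..π,
        Complex.exp (-(m * t * Complex.I)) * v (polarPoint (r, t)) := by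
  have hexp (t : ℝ) : HasDerivAt (fun t : ℝ => Complex.exp (-(m * t * Complex.I)))
      (Complex.exp (-(m * t * Complex.I)) * -(m * Complex.I)) t := by
    simpa using (((hasDerivAt_id (t : ℂ)).const_mul (m : ℂ)).mul_const
      Complex.I).neg.cexp.comp_ofReal
  have hang : Continuous fun t => fderiv ℝ v (polarPoint (r, t)) (angularVec t) :=
    (continuous_fderiv_polarPoint_apply hv continuous_angularVec).comp (.prodMk_right r)
  have hend : Complex.exp (-(m * (π : ℝ) * Complex.I)) * v (polarPoint (r, π))
      = Complex.exp (-(m * (-π : ℝ) * Complex.I)) * v (polarPoint (r, -π)) := by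
    have hpt : polarPoint (r, -π) = polarPoint (r, π) := by simp [polarPoint]
    have hper := Complex.exp_periodic.int_mul m (-(m * π * Complex.I))
    rw [hpt, ← hper]
    congr 2
    push_cast
    ring
  have hparts := intervalIntegral.integral_mul_deriv_eq_deriv_mul (a := -π) (b := π)
    (fun t _ => hexp t) (fun t _ => hasDerivAt_comp_polarPoint_snd hv r t)
    (Continuous.intervalIntegrable (by fun_prop) _ _)
    (Continuous.intervalIntegrable (by fun_prop) _ _)
  rw [hend, sub_self, zero_sub, ← intervalIntegral.integral_neg] at hparts
  simp only [← intervalIntegral.integral_const_mul]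
  calc _ = _ := intervalIntegral.integral_congr fun t _ => by ring
    _ = _ := hparts
    _ = _ := intervalIntegral.integral_congr fun t _ => by ring

theorem mul_deriv_circleCoeff_sub (hv : ContDiff ℝ 1 v) (m : ℤ) (r : ℝ) :
    r * deriv (circleCoeff v m) r - m * circleCoeff v m r
      = r * circleCoeff (cauchyRiemann v) (m + 1) r := by
  have hrad : Continuous fun t => fderiv ℝ v (polarPoint (r, t)) (radialVec t) :=
    (continuous_fderiv_polarPoint_apply hv continuous_radialVec).comp (.prodMk_right r)
  have hang : Continuous fun t => fderiv ℝ v (polarPoint (r, t)) (angularVec t) :=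
    (continuous_fderiv_polarPoint_apply hv continuous_angularVec).comp (.prodMk_right r)
  have hCR : ∫ t in (-π)..π,
        Complex.exp (-((m + 1 : ℤ) * t * Complex.I)) * cauchyRiemann v (polarPoint (r, t))
      = (∫ t in (-π)..π,
          Complex.exp (-(m * t * Complex.I)) * fderiv ℝ v (polarPoint (r, t)) (radialVec t))
        + Complex.I * ∫ t in (-π)..π,
          Complex.exp (-(m * t * Complex.I)) * fderiv ℝ v (polarPoint (r, t)) (angularVec t) := by
    rw [← intervalIntegral.integral_const_mul, ← intervalIntegral.integral_add
      (Continuous.intervalIntegrable (by fun_prop) _ _)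
      (Continuous.intervalIntegrable (by fun_prop) _ _)]
    refine intervalIntegral.integral_congr fun t _ => ?_
    have hsplit : Complex.exp (-((m + 1 : ℤ) * t * Complex.I))
        = Complex.exp (-(m * t * Complex.I)) * Complex.exp (-(t * Complex.I)) := by
      rw [← Complex.exp_add]
      push_cast
      ring_nf
    calc _ = Complex.exp (-(m * t * Complex.I)) * (fderiv ℝ v (polarPoint (r, t)) (radialVec t)
          + Complex.I * fderiv ℝ v (polarPoint (r, t)) (angularVec t)) := by
          rw [hsplit, mul_assoc, fderiv_radialVec_add_I_mul]
      _ = _ := by ring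
  rw [(hasDerivAt_circleCoeff hv m r).deriv, circleCoeff, circleCoeff, hCR]
  simp only [Complex.real_smul]
  set J := ∫ t in (-π)..π, Complex.exp (-(m * t * Complex.I)) * v (polarPoint (r, t))
  linear_combination (-((2 * π)⁻¹ : ℝ) : ℂ) * (Complex.I *
    intervalIntegral_exp_mul_fderiv_angularVec hv m r + m * J * Complex.I_sq)

end CircleCoefficients

section HardyWeights

variable {α ρ : ℝ}

theorem gMinus_of_le {r : ℝ} (h : r ≤ ρ) : gMinus α ρ r = 1 := by
  simp [gMinus, gPlus, h]

theorem gMinus_sq_of_ge {r : ℝ} (hρ : 0 < ρ) (h : ρ ≤ r) :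
    gMinus α ρ r ^ 2 = ρ ^ (2 * α) * r ^ (-2 * α) := by
  have hr : 0 < r := hρ.trans_le h
  rcases h.eq_or_lt with rfl | h
  · rw [gMinus_of_le le_rfl, ← rpow_add hρ]
    simp
  · have hsq : ρ ^ (2 * α) * r ^ (-2 * α) = (ρ ^ α * r ^ (-α)) ^ 2 := by
      rw [mul_pow, ← rpow_mul_natCast hρ.le, ← rpow_mul_natCast hr.le]
      congr 2 <;> push_cast <;> ring
    rw [hsq, gMinus, gPlus, if_neg (not_le.2 h), rpow_neg hρ.le, rpow_neg hr.le]
    field_simp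

theorem gMinus_pos {r : ℝ} (hρ : 0 < ρ) : 0 < gMinus α ρ r := by
  unfold gMinus gPlus
  split_ifs with h
  · norm_num
  · have : 0 < r := hρ.trans (not_le.1 h)
    positivity

theorem hasDerivAt_gMinus_sq_of_lt {r : ℝ} (hr : r < ρ) :
    HasDerivAt (fun r => gMinus α ρ r ^ 2) 0 r := by
  refine (hasDerivAt_const r (1 : ℝ)).congr_of_eventuallyEq ?_
  filter_upwards [Iio_mem_nhds hr] with s hs
  rw [gMinus_of_le (mem_Iio.1 hs).le, one_pow]

theorem hasDerivAt_gMinus_sq_of_gt {r : ℝ} (hρ : 0 < ρ) (hr : ρ < r) :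
    HasDerivAt (fun r => gMinus α ρ r ^ 2) (-2 * α * gMinus α ρ r ^ 2 / r) r := by
  have hr0 : 0 < r := hρ.trans hr
  have h := (hasDerivAt_rpow_const (p := -2 * α) (Or.inl hr0.ne')).const_mul (ρ ^ (2 * α))
  refine (h.congr_of_eventuallyEq ?_).congr_deriv ?_
  · filter_upwards [Ioi_mem_nhds hr] with s hs using gMinus_sq_of_ge hρ (mem_Ioi.1 hs).le
  · rw [gMinus_sq_of_ge hρ hr.le, rpow_sub_one hr0.ne']
    ring

theorem continuous_gMinus_sq (hρ : 0 < ρ) : Continuous fun r => gMinus α ρ r ^ 2 := by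
  have h : (fun r => gMinus α ρ r ^ 2)
      = fun r => if r ≤ ρ then 1 else ρ ^ (2 * α) * r ^ (-2 * α) := by
    funext r
    split_ifs with h
    · rw [gMinus_of_le h, one_pow]
    · rw [gMinus_sq_of_ge hρ (not_le.1 h).le]
  rw [h]
  refine continuous_if_le continuous_id continuous_const continuousOn_const ?_ ?_
  · exact continuousOn_const.mul fun x hx =>
      (continuousAt_rpow_const _ _ (.inl (hρ.trans_le hx).ne')).continuousWithinAt
  · rintro x rfl
    rw [← rpow_add hρ]
    simp

theorem continuous_cauchyRiemann {v : Plane → ℂ} (hv : ContDiff ℝ 1 v) :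
    Continuous (cauchyRiemann v) := by
  have hd (j : Fin 2) : Continuous (partialC j v) :=
    (hv.continuous_fderiv one_ne_zero).clm_apply continuous_const
  exact (hd 0).add (continuous_const.mul (hd 1))

theorem norm_sub_smul_sq_real {E : Type*} [NormedAddCommGroup E] [InnerProductSpace ℝ E] (x y : E)
    (a c : ℝ) :
    ‖x - a • y‖ ^ 2
      = ‖x - c • y‖ ^ 2 + (c - a) * (2 * inner ℝ y x) + (a ^ 2 - c ^ 2) * ‖y‖ ^ 2 := by
  simp only [norm_sub_sq_real, inner_smul_right, norm_smul, mul_pow, norm_eq_abs, sq_abs,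
    real_inner_comm]
  ring

-- The drift `c = α + Q` is compared with `m` in `norm_sub_smul_sq_real`; the weight `G` behaves
-- like `r ^ (-2 α)`, so that the cross term integrates to the boundary terms on the left-hand side.
theorem boundary_add_integral_le_of_drift {E : Type*} [NormedAddCommGroup E]
    [InnerProductSpace ℝ E] {f d : ℝ → E} {m a b : ℝ} {G Q Q' W : ℝ → ℝ}
    (ha : 0 ≤ a) (hab : a ≤ b) (hf : Differentiable ℝ f) (hd : Continuous d)
    (hfd : ∀ r, r • deriv f r - m • f r = r • d r)
    (hG : ContinuousOn G (Icc a b)) (hG0 : ∀ r, 0 ≤ G r)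
    (hG' : ∀ r ∈ Ioo a b, HasDerivAt G (-2 * α * G r / r) r)
    (hQ : ContinuousOn Q (Icc a b)) (hQ' : ∀ r ∈ Ioo a b, HasDerivAt Q (Q' r) r)
    (hW : Continuous W)
    (hWQ : ∀ r ∈ Ioo a b, W r ≤ ((m - α) ^ 2 - Q r ^ 2 - r * Q' r) / r ^ 2) :
    G b * (α - m + Q b) * ‖f b‖ ^ 2 - G a * (α - m + Q a) * ‖f a‖ ^ 2
        + ∫ r in a..b, r * (G r * W r * ‖f r‖ ^ 2)
      ≤ ∫ r in a..b, r * (G r * ‖d r‖ ^ 2) := by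
  have hfc := hf.continuous
  have hIcc := uIcc_of_le hab
  have hint₁ : ContinuousOn (fun r => r * (G r * ‖d r‖ ^ 2)) (Icc a b) := by fun_prop
  have hint₂ : ContinuousOn (fun r => r * (G r * W r * ‖f r‖ ^ 2)) (Icc a b) := by fun_prop
  have hderiv (r : ℝ) (hr : r ∈ Ioo a b) := (((hG' r hr).mul
    ((hQ' r hr).const_add (α - m))).mul (hf r).hasDerivAt.norm_sq).hasDerivWithinAt (s := Ioi r)
  have key := intervalIntegral.sub_le_integral_of_hasDeriv_right_of_le hab
    (φ := fun r => r * (G r * ‖d r‖ ^ 2) - r * (G r * W r * ‖f r‖ ^ 2))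
    ((hG.mul (hQ.const_add _)).mul (hfc.norm.pow 2).continuousOn) hderiv
    (hint₁.sub hint₂).integrableOn_Icc fun r hr => ?_
  · rw [intervalIntegral.integral_sub (hIcc ▸ hint₁).intervalIntegrable
      (hIcc ▸ hint₂).intervalIntegrable] at key
    exact le_sub_iff_add_le.1 key
  · have hr0 : 0 < r := ha.trans_lt hr.1
    have hsq := norm_sub_smul_sq_real (r • deriv f r) (f r) m (α + Q r)
    rw [hfd, norm_smul, norm_eq_abs, mul_pow, sq_abs, inner_smul_right] at hsq
    have hW' := (le_div_iff₀ (by positivity)).1 (hWQ r hr)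
    have hn : 0 ≤ ‖f r‖ ^ 2 := by positivity
    have hpos : 0 ≤ G r / r * (‖r • deriv f r - (α + Q r) • f r‖ ^ 2
        + ((m - α) ^ 2 - Q r ^ 2 - r * Q' r - W r * r ^ 2) * ‖f r‖ ^ 2) :=
      mul_nonneg (div_nonneg (hG0 r) hr0.le)
        (add_nonneg (sq_nonneg _) (mul_nonneg (sub_nonneg.2 hW') hn))
    refine sub_nonneg.1 (hpos.trans_eq ?_)
    have : ‖r • deriv f r - (α + Q r) • f r‖ ^ 2 = r ^ 2 * ‖d r‖ ^ 2
        - (α + Q r - m) * (2 * (r * inner ℝ (f r) (deriv f r)))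
        - (m ^ 2 - (α + Q r) ^ 2) * ‖f r‖ ^ 2 := by linarith
    rw [this]
    simp only [Pi.mul_apply]
    field_simp
    ring

/-- A supersolution for the radial Riccati inequality behind the Hardy inequality with weight `W`:
`-lam r² / ρ²` serves as the drift for `r < ρ` and `Q` for `r > ρ`, and `jump` makes the boundary
terms at `r = ρ` cancel favourably. -/
structure IsHardyDrift (α ρ lam : ℝ) (Q Q' W : ℝ → ℝ) : Prop where
  continuous : Continuous W
  hasDerivAt : ∀ r, ρ ≤ r → HasDerivAt Q (Q' r) r
  inner : ∀ r, 0 < r → r < ρ → W r ≤ (2 * lam - lam ^ 2 * r ^ 2 / ρ ^ 2) / ρ ^ 2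
  outer : ∀ r, ρ < r → W r ≤ (distInt α ^ 2 - Q r ^ 2 - r * Q' r) / r ^ 2
  jump : lam + α + Q ρ ≤ 0

theorem distInt_nonneg (α : ℝ) : 0 ≤ distInt α := le_ciInf fun _ => abs_nonneg _

theorem distInt_le (α : ℝ) (m : ℤ) : distInt α ≤ |(m : ℝ) - α| :=
  ciInf_le ⟨0, by rintro _ ⟨n, rfl⟩; exact abs_nonneg _⟩ m

theorem distInt_le_one (α : ℝ) : distInt α ≤ 1 := by
  refine (distInt_le α ⌊α⌋).trans ?_
  rw [abs_le]
  constructor <;> linarith [Int.floor_le α, Int.lt_floor_add_one α]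

theorem distInt_sq_le (α : ℝ) (m : ℤ) : distInt α ^ 2 ≤ ((m : ℝ) - α) ^ 2 := by
  rw [← sq_abs ((m : ℝ) - α)]
  exact pow_le_pow_left₀ (distInt_nonneg α) (distInt_le α m) 2

namespace IsHardyDrift

variable {lam R : ℝ} {Q Q' W : ℝ → ℝ} {m : ℤ} {E : Type*} [NormedAddCommGroup E]
  [InnerProductSpace ℝ E] {f d : ℝ → E}

theorem intervalIntegral_disc_le (h : IsHardyDrift α ρ lam Q Q' W) (hρ : 0 < ρ)
    (hf : Differentiable ℝ f) (hd : Continuous d)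
    (hfd : ∀ r, r • deriv f r - (m : ℝ) • f r = r • d r) :
    ∫ r in (0 : ℝ)..ρ, r * (gMinus α ρ r ^ 2 * W r * ‖f r‖ ^ 2)
      ≤ (∫ r in (0 : ℝ)..ρ, r * (gMinus α ρ r ^ 2 * ‖d r‖ ^ 2)) + (m + lam) * ‖f ρ‖ ^ 2 := by
  have hf0 : m * ‖f 0‖ ^ 2 = 0 := by
    have := hfd 0
    rw [zero_smul, zero_smul, zero_sub, neg_eq_zero, smul_eq_zero] at this
    rcases this with h | h <;> simp [h]
  have key := boundary_add_integral_le_of_drift (α := 0) (G := fun r => gMinus α ρ r ^ 2)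
    (Q := fun r => -lam * r ^ 2 / ρ ^ 2) (Q' := fun r => -lam * (2 * r) / ρ ^ 2)
    le_rfl hρ.le hf hd hfd (continuous_gMinus_sq hρ).continuousOn (fun _ => sq_nonneg _)
    (fun r hr => (hasDerivAt_gMinus_sq_of_lt hr.2).congr_deriv (by simp)) (by fun_prop)
    (fun r _ => (((hasDerivAt_pow 2 r).const_mul (-lam)).div_const (ρ ^ 2)).congr_deriv (by simp))
    h.continuous fun r hr => (h.inner r hr.1 hr.2).trans ?_
  · rw [mul_div_cancel_right₀ _ (by positivity : ρ ^ 2 ≠ 0), gMinus_of_le le_rfl,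
      gMinus_of_le hρ.le] at key
    simp only [one_pow, zero_sub, one_mul, ne_eq, OfNat.ofNat_ne_zero, not_false_eq_true, zero_pow,
      mul_zero, zero_div, add_zero, mul_neg, neg_mul, sub_neg_eq_add] at key
    linarith
  · have hr := hr.1
    rw [← sub_nonneg]
    calc (0 : ℝ) ≤ (m : ℝ) ^ 2 / r ^ 2 := by positivity
      _ = _ := by
        field_simp
        ring

theorem intervalIntegral_exterior_le (h : IsHardyDrift α ρ lam Q Q' W) (hρ : 0 < ρ) (hR : ρ ≤ R)
    (hf : Differentiable ℝ f) (hd : Continuous d)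
    (hfd : ∀ r, r • deriv f r - (m : ℝ) • f r = r • d r) (hfR : f R = 0) :
    ∫ r in ρ..R, r * (gMinus α ρ r ^ 2 * W r * ‖f r‖ ^ 2)
      ≤ (∫ r in ρ..R, r * (gMinus α ρ r ^ 2 * ‖d r‖ ^ 2)) + (α - m + Q ρ) * ‖f ρ‖ ^ 2 := by
  have key := boundary_add_integral_le_of_drift (α := α) (G := fun r => gMinus α ρ r ^ 2)
    hρ.le hR hf hd hfd (continuous_gMinus_sq hρ).continuousOn (fun _ => sq_nonneg _)
    (fun r hr => hasDerivAt_gMinus_sq_of_gt hρ hr.1)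
    (fun r hr => (h.hasDerivAt r hr.1).continuousAt.continuousWithinAt)
    (fun r hr => h.hasDerivAt r hr.1.le) h.continuous fun r hr => (h.outer r hr.1).trans ?_
  · rw [hfR, gMinus_of_le le_rfl] at key
    simp only [norm_zero, ne_eq, OfNat.ofNat_ne_zero, not_false_eq_true, zero_pow, mul_zero,
      one_pow, one_mul, zero_sub, neg_add_le_iff_le_add] at key
    linarith
  · have := distInt_sq_le α m
    gcongr ?_ / r ^ 2
    linarith

theorem intervalIntegral_le (h : IsHardyDrift α ρ lam Q Q' W) (hρ : 0 < ρ) (hR : ρ ≤ R)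
    (hf : Differentiable ℝ f) (hd : Continuous d)
    (hfd : ∀ r, r • deriv f r - (m : ℝ) • f r = r • d r) (hfR : f R = 0) :
    ∫ r in (0 : ℝ)..R, r * (gMinus α ρ r ^ 2 * W r * ‖f r‖ ^ 2)
      ≤ ∫ r in (0 : ℝ)..R, r * (gMinus α ρ r ^ 2 * ‖d r‖ ^ 2) := by
  have hg := continuous_gMinus_sq (α := α) hρ
  have hfc := hf.continuous
  have hWc := h.continuous
  have hdisc := h.intervalIntegral_disc_le hρ hf hd hfd
  have hext := h.intervalIntegral_exterior_le hρ hR hf hd hfd hfR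
  have hjump : (lam + α + Q ρ) * ‖f ρ‖ ^ 2 ≤ 0 :=
    mul_nonpos_of_nonpos_of_nonneg h.jump (sq_nonneg _)
  rw [← intervalIntegral.integral_add_adjacent_intervals (b := ρ)
      (Continuous.intervalIntegrable (by fun_prop) _ _)
      (Continuous.intervalIntegrable (by fun_prop) _ _),
    ← intervalIntegral.integral_add_adjacent_intervals (b := ρ)
      (Continuous.intervalIntegrable (by fun_prop) 0 ρ)
      (Continuous.intervalIntegrable (by fun_prop) ρ R)]
  linarith

theorem integral_le (h : IsHardyDrift α ρ lam Q Q' W) (hρ : 0 < ρ) {v : Plane → ℂ}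
    (hv : ContDiff ℝ 1 v) (hvc : HasCompactSupport v) :
    ∫ x, gMinus α ρ ‖x‖ ^ 2 * W ‖x‖ * ‖v x‖ ^ 2
      ≤ ∫ x, gMinus α ρ ‖x‖ ^ 2 * ‖cauchyRiemann v x‖ ^ 2 := by
  have hg := continuous_gMinus_sq (α := α) hρ
  obtain ⟨R₀, hR₀⟩ := hvc.isCompact.isBounded.subset_closedBall (0 : Plane)
  set R := max (R₀ + 1) ρ
  have hρR : ρ ≤ R := le_max_right _ _
  have hzero : ∀ x, R ≤ ‖x‖ → x ∉ tsupport v := fun x hx hmem => by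
    linarith [mem_closedBall_zero_iff.1 (hR₀ hmem), le_max_left (R₀ + 1) ρ]
  have hv0 : ∀ x, R ≤ ‖x‖ → v x = 0 := fun x hx => image_eq_zero_of_notMem_tsupport (hzero x hx)
  have hd0 : ∀ x, R < ‖x‖ → cauchyRiemann v x = 0 := fun x hx => by
    simp [cauchyRiemann, partialC, fderiv_of_notMem_tsupport ℝ (hzero x hx.le)]
  have hsum_v := hasSum_intervalIntegral_circleCoeff_sq hv.continuous
    (W := fun r => gMinus α ρ r ^ 2 * W r) (hg.mul h.continuous)
    (hρ.le.trans hρR) fun x hx => hv0 x hx.le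
  have hsum_d := (Equiv.addRight (1 : ℤ)).hasSum_iff.2
    (hasSum_intervalIntegral_circleCoeff_sq (continuous_cauchyRiemann hv) hg (hρ.le.trans hρR) hd0)
  refine hasSum_le (fun m => ?_) hsum_v hsum_d
  rw [Function.comp_apply, Equiv.coe_addRight]
  refine mul_le_mul_of_nonneg_left (h.intervalIntegral_le hρ hρR (m := m)
    (fun r => (hasDerivAt_circleCoeff hv m r).differentiableAt)
    (continuous_circleCoeff (continuous_cauchyRiemann hv) (m + 1)) (fun r => ?_) ?_) (by positivity)
  · simpa only [Complex.real_smul, Complex.ofReal_intCast] using mul_deriv_circleCoeff_sub hv m r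
  · have hzero : ∀ t, v (polarPoint (R, t)) = 0 := fun t =>
      hv0 _ (by rw [norm_polarPoint]; exact le_abs_self R)
    simp [circleCoeff, hzero]

end IsHardyDrift

theorem isHardyDrift_distInt (hα : α ≤ 0) (hρ : 0 < ρ) :
    IsHardyDrift α ρ (distInt α) 0 0 fun r => distInt α ^ 2 * (ρ ^ 2 + r ^ 2)⁻¹ where
  continuous := continuous_const.mul (.inv₀ (by fun_prop) fun r => by positivity)
  hasDerivAt r _ := hasDerivAt_const r 0
  inner r hr hrρ := by
    have hμ₀ := distInt_nonneg α
    have hμ₁ := distInt_le_one α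
    have hr2 : r ^ 2 ≤ ρ ^ 2 := by gcongr
    calc distInt α ^ 2 * (ρ ^ 2 + r ^ 2)⁻¹ ≤ distInt α ^ 2 * (ρ ^ 2)⁻¹ := by
          gcongr
          exact le_add_of_nonneg_right (sq_nonneg r)
      _ = distInt α ^ 2 / ρ ^ 2 := (div_eq_mul_inv _ _).symm
      _ ≤ (2 * distInt α - distInt α ^ 2 * r ^ 2 / ρ ^ 2) / ρ ^ 2 := by
        have : distInt α ^ 2 * r ^ 2 / ρ ^ 2 ≤ distInt α ^ 2 := by
          rw [div_le_iff₀ (by positivity)]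
          gcongr
        gcongr
        nlinarith
  outer r hr := by
    have hr0 := hρ.trans hr
    simp only [Pi.zero_apply, mul_zero, sub_zero, ne_eq, OfNat.ofNat_ne_zero, not_false_eq_true,
      zero_pow, div_eq_mul_inv]
    gcongr
    exact le_add_of_nonneg_left (sq_nonneg ρ)
  jump := by
    have : distInt α ≤ -α := by simpa [abs_of_nonpos hα] using distInt_le α 0
    simpa using by linarith

/-- The logarithmic weight `1 / (ρ² + r² (1 + log² (r / ρ)))`. -/
def logWeight (ρ r : ℝ) : ℝ := (ρ ^ 2 + r ^ 2 * (1 + log (r / ρ) ^ 2))⁻¹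

theorem logWeight_nonneg (ρ r : ℝ) : 0 ≤ logWeight ρ r := by
  unfold logWeight
  positivity

theorem logWeight_le_inner (hρ : 0 < ρ) (r : ℝ) : logWeight ρ r ≤ (ρ ^ 2)⁻¹ := by
  unfold logWeight
  gcongr
  exact le_add_of_nonneg_right (by positivity)

theorem logWeight_le_outer (ρ : ℝ) {r : ℝ} (hr : 0 < r) :
    logWeight ρ r ≤ (r ^ 2 * (1 + log (r / ρ) ^ 2))⁻¹ := by
  unfold logWeight
  gcongr
  exact le_add_of_nonneg_left (sq_nonneg ρ)

theorem continuous_logWeight (hρ : 0 < ρ) : Continuous (logWeight ρ) := by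
  have : Continuous fun r : ℝ => r / ρ * log (r / ρ) :=
    continuous_mul_log.comp (continuous_id.div_const ρ)
  have heq : logWeight ρ = fun r => (ρ ^ 2 + r ^ 2 + ρ ^ 2 * (r / ρ * log (r / ρ)) ^ 2)⁻¹ := by
    funext r
    unfold logWeight
    congr 1
    field_simp
    ring
  rw [heq]
  exact .inv₀ (by fun_prop) fun r => by positivity

theorem hasDerivAt_inv_log_add {b r : ℝ} (hρ : 0 < ρ) (hr : 0 < r) (hb : 0 < log (r / ρ) + b) :
    HasDerivAt (fun r => (2 * (log (r / ρ) + b))⁻¹) (-(2 * (log (r / ρ) + b) ^ 2 * r)⁻¹) r := by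
  have h : HasDerivAt (fun r => 2 * (log (r / ρ) + b)) (2 * (1 / ρ / (r / ρ))) r :=
    ((((hasDerivAt_id r).div_const ρ).log (by positivity)).add_const b).const_mul 2
  refine (h.inv (by positivity)).congr_deriv ?_
  field_simp

theorem isHardyDrift_logWeight (hρ : 0 < ρ) {b : ℝ} (hb : 0 < b)
    (hjump : 1 / 4 + α + (2 * b)⁻¹ ≤ 0) :
    IsHardyDrift α ρ (1 / 4) (fun r => (2 * (log (r / ρ) + b))⁻¹)
      (fun r => -(2 * (log (r / ρ) + b) ^ 2 * r)⁻¹)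
      fun r => (4 * (1 + b ^ 2))⁻¹ * logWeight ρ r where
  continuous := continuous_const.mul (continuous_logWeight hρ)
  hasDerivAt r hr := by
    have hlog : 0 ≤ log (r / ρ) := log_nonneg ((one_le_div hρ).2 hr)
    exact hasDerivAt_inv_log_add hρ (hρ.trans_le hr) (by positivity)
  inner r hr hrρ := by
    have hC : (4 * (1 + b ^ 2))⁻¹ ≤ 1 / 4 := by
      rw [one_div]
      exact inv_anti₀ (by norm_num) (by nlinarith)
    have hr2 : r ^ 2 ≤ ρ ^ 2 := by gcongr
    have hquad : (1 / 4 : ℝ) ^ 2 * r ^ 2 / ρ ^ 2 ≤ 1 / 16 := by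
      rw [div_le_iff₀ (by positivity)]
      nlinarith
    calc (4 * (1 + b ^ 2))⁻¹ * logWeight ρ r ≤ 1 / 4 * (ρ ^ 2)⁻¹ := by
          gcongr
          exacts [logWeight_nonneg ρ r, logWeight_le_inner hρ r]
      _ = 1 / 4 / ρ ^ 2 := (div_eq_mul_inv _ _).symm
      _ ≤ (2 * (1 / 4) - (1 / 4) ^ 2 * r ^ 2 / ρ ^ 2) / ρ ^ 2 := by
        gcongr
        linarith
  outer r hr := by
    have hr0 := hρ.trans hr
    set t := log (r / ρ)
    have ht : 0 ≤ t := log_nonneg ((one_le_div hρ).2 hr.le)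
    have hriccati : -((2 * (t + b))⁻¹) ^ 2 - r * -(2 * (t + b) ^ 2 * r)⁻¹
        = (4 * (t + b) ^ 2)⁻¹ := by
      field_simp
      ring
    have hcauchy : (t + b) ^ 2 ≤ (1 + b ^ 2) * (1 + t ^ 2) := by
      nlinarith [sq_nonneg (t * b - 1)]
    calc (4 * (1 + b ^ 2))⁻¹ * logWeight ρ r
        ≤ (4 * (1 + b ^ 2))⁻¹ * (r ^ 2 * (1 + t ^ 2))⁻¹ := by
          gcongr
          exact logWeight_le_outer ρ hr0
      _ = (4 * ((1 + b ^ 2) * (1 + t ^ 2)))⁻¹ / r ^ 2 := by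
        field_simp
      _ ≤ (4 * (t + b) ^ 2)⁻¹ / r ^ 2 := by gcongr
      _ ≤ _ := by
        rw [← hriccati]
        gcongr ?_ / r ^ 2
        linarith [sq_nonneg (distInt α)]
  jump := by simpa [div_self hρ.ne'] using hjump

theorem exists_isHardyDrift_logWeight (hα : α ≤ 0) (hint : ∃ n : ℤ, (n : ℝ) = α) (hρ : 0 < ρ) :
    ∃ lam Q Q', IsHardyDrift α ρ lam Q Q' fun r => |α| / (4 * |α| + π) * logWeight ρ r := by
  rcases hα.eq_or_lt with rfl | hneg
  · exact ⟨0, 0, 0, by simpa using continuous_const, fun r _ => hasDerivAt_const r 0,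
      by simp, by simp [div_nonneg, sq_nonneg], by simp⟩
  have hα₁ : 1 ≤ -α := by
    obtain ⟨n, rfl⟩ := hint
    have : n ≤ -1 := Int.le_sub_one_of_lt (by exact_mod_cast hneg)
    exact_mod_cast (by lia : 1 ≤ -n)
  rw [abs_of_neg hneg]
  obtain ⟨a, rfl⟩ : ∃ a, α = -a := ⟨-α, (neg_neg α).symm⟩
  rw [neg_neg] at hα₁ ⊢
  set b := √(π / (4 * a))
  have hb2 : b ^ 2 = π / (4 * a) := sq_sqrt (by positivity)
  have hC : a / (4 * a + π) = (4 * (1 + b ^ 2))⁻¹ := by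
    rw [hb2]
    field_simp
  rw [hC]
  refine ⟨_, _, _, isHardyDrift_logWeight hρ (sqrt_pos.2 (by positivity)) ?_⟩
  have hsq : ((2 * b)⁻¹) ^ 2 = a / π := by
    rw [inv_pow, mul_pow, hb2]
    field_simp
    norm_num
  have hle : (2 * b)⁻¹ ≤ a - 1 / 4 := by
    refine (abs_le_of_sq_le_sq' ?_ (by linarith)).2
    rw [hsq, div_le_iff₀ pi_pos]
    nlinarith [pi_gt_three, sq_nonneg (a - 1 / 4)]
  linarith

end HardyWeights

section Integrability

variable {B : Plane → ℝ}

theorem finrank_plane : Module.finrank ℝ Plane = 2 := by simp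

theorem measurable_norm_sub_rpow (x : Plane) (s : ℝ) :
    Measurable fun y : Plane => ‖x - y‖ ^ s :=
  (measurable_const.sub measurable_id).norm.pow_const s

theorem integrableOn_norm_rpow_compl_closedBall {s R : ℝ} (hs : 2 < s) (hR : 1 ≤ R) :
    IntegrableOn (fun y : Plane => ‖y‖ ^ (-s)) (Metric.closedBall 0 R)ᶜ := by
  have hi : Integrable fun y : Plane => (2 : ℝ) ^ s * (1 + ‖y‖) ^ (-s) :=
    (integrable_one_add_norm (by rw [finrank_plane]; exact_mod_cast hs)).const_mul _
  refine hi.integrableOn.mono' (measurable_norm.pow_const _).aestronglyMeasurable ?_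
  refine (ae_restrict_iff' Metric.isClosed_closedBall.measurableSet.compl).2
    (Eventually.of_forall fun y hy => ?_)
  have hRy : R < ‖y‖ := by simpa using hy
  have hy0 : 0 < ‖y‖ := by linarith
  calc ‖‖y‖ ^ (-s)‖ = 2 ^ s * (2 * ‖y‖) ^ (-s) := by
        rw [norm_of_nonneg (by positivity), mul_rpow zero_le_two hy0.le, ← mul_assoc,
          ← rpow_add two_pos, add_neg_cancel, rpow_zero, one_mul]
    _ ≤ 2 ^ s * (1 + ‖y‖) ^ (-s) := by
        refine mul_le_mul_of_nonneg_left ?_ (by positivity)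
        exact rpow_le_rpow_of_nonpos (by positivity) (by linarith) (by linarith)

theorem integrable_indicator_ball_norm_rpow {a : ℝ} (ha : a < 2) :
    Integrable ((Metric.ball (0 : Plane) 1).indicator fun z => ‖z‖ ^ (-a)) := by
  rw [integrable_indicator_iff Metric.isOpen_ball.measurableSet]
  refine integrableOn_ball_of_norm_le_rpow (C := 1) (α := a) (by simp)
    (by rw [finrank_plane]; exact_mod_cast ha) (Eventually.of_forall fun x => ?_)
    (measurable_norm.pow_const _).aestronglyMeasurable
  rw [one_mul, norm_of_nonneg (by positivity)]

theorem memLp_of_norm_le_rpow {f : Plane → ℝ} {q : ℝ≥0∞} {C R s : ℝ} (hq : 1 ≤ q) (hq' : q ≠ ⊤)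
    (hs : 2 < s) (hR : 1 ≤ R) (hf : AEStronglyMeasurable f)
    (hfR : MemLp f q (volume.restrict (Metric.closedBall 0 R)))
    (hdecay : ∀ᵐ y, R < ‖y‖ → ‖f y‖ ≤ C * ‖y‖ ^ (-s)) : MemLp f q := by
  have hK : MeasurableSet (Metric.closedBall (0 : Plane) R) :=
    Metric.isClosed_closedBall.measurableSet
  have hq1 : 1 ≤ q.toReal := by simpa using ENNReal.toReal_mono hq' hq
  have hpow : MemLp (fun y : Plane => C * ‖y‖ ^ (-s)) q
      (volume.restrict (Metric.closedBall 0 R)ᶜ) := by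
    refine MemLp.const_mul ?_ C
    rw [← integrable_norm_rpow_iff (measurable_norm.pow_const _).aestronglyMeasurable
      (one_pos.trans_le hq).ne' hq']
    refine (integrableOn_norm_rpow_compl_closedBall (s := s * q.toReal) (by nlinarith) hR).congr
      (Eventually.of_forall fun y => ?_)
    simp only [norm_of_nonneg (rpow_nonneg (norm_nonneg y) _), ← rpow_mul (norm_nonneg y),
      neg_mul]
  have hfRc : MemLp f q (volume.restrict (Metric.closedBall 0 R)ᶜ) := by
    refine hpow.mono hf.restrict ((ae_restrict_iff' hK.compl).2 ?_)
    filter_upwards [hdecay] with y hy hyR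
    exact (hy (by simpa using hyR)).trans (le_abs_self _)
  rw [← indicator_self_add_compl (Metric.closedBall 0 R) f]
  exact ((memLp_indicator_iff_restrict hK).2 hfR).add
    ((memLp_indicator_iff_restrict hK.compl).2 hfRc)

theorem AdmissibleField.aestronglyMeasurable (hB : AdmissibleField B) :
    AEStronglyMeasurable B := by
  obtain ⟨⟨p, -, hp⟩, -⟩ := hB
  have h : ∀ n : ℕ, AEStronglyMeasurable B
      (volume.restrict (Metric.closedBall (0 : Plane) n)) := fun n =>
    (hp _ (isCompact_closedBall 0 (n : ℝ))).1
  simpa only [Metric.iUnion_closedBall_nat, Measure.restrict_univ] using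
    aestronglyMeasurable_iUnion_iff.2 h

theorem AdmissibleField.exists_decay (hB : AdmissibleField B) :
    ∃ τ C R : ℝ, 2 < τ ∧ 1 ≤ R ∧ ∀ᵐ y : Plane, R < ‖y‖ → ‖B y‖ ≤ C * ‖y‖ ^ (-τ) := by
  obtain ⟨-, τ, hτ, C, R, h⟩ := hB
  refine ⟨τ, C, max R 1, hτ, le_max_right _ _, ?_⟩
  filter_upwards [h] with y hy hRy
  exact hy ((le_max_left R 1).trans hRy.le)

theorem AdmissibleField.exists_memLp (hB : AdmissibleField B) :
    ∃ q : ℝ, 2 < q ∧ MemLp B (ENNReal.ofReal q) := by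
  obtain ⟨τ, C, R, hτ, hR, hdecay⟩ := hB.exists_decay
  obtain ⟨p, hp2, hp⟩ := hB.1
  have htop : min p 3 ≠ ⊤ := ne_top_of_le_ne_top (by norm_num) (min_le_right p 3)
  have h2 : 2 < min p 3 := lt_min hp2 (by norm_num)
  refine ⟨(min p 3).toReal, ?_, ?_⟩
  · simpa using (ENNReal.toReal_lt_toReal (by norm_num) htop).2 h2
  · have : IsFiniteMeasure (volume.restrict (Metric.closedBall (0 : Plane) R)) :=
      isFiniteMeasure_restrict.2 (isCompact_closedBall 0 R).measure_lt_top.ne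
    rw [ENNReal.ofReal_toReal htop]
    exact memLp_of_norm_le_rpow (one_le_two.trans h2.le) htop hτ hR hB.aestronglyMeasurable
      ((hp _ (isCompact_closedBall 0 R)).mono_exponent (min_le_left p 3)) hdecay

theorem AdmissibleField.exists_integrable_moment (hB : AdmissibleField B) :
    Integrable B ∧ ∃ s : ℝ, 0 < s ∧ Integrable fun y => |B y| * ‖y‖ ^ s := by
  obtain ⟨τ, C, R, hτ, hR, hdecay⟩ := hB.exists_decay
  obtain ⟨p, hp2, hp⟩ := hB.1
  have hm := hB.aestronglyMeasurable
  have hK := isCompact_closedBall (0 : Plane) R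
  have : IsFiniteMeasure (volume.restrict (Metric.closedBall (0 : Plane) R)) :=
    isFiniteMeasure_restrict.2 hK.measure_lt_top.ne
  have hBR : MemLp B 1 (volume.restrict (Metric.closedBall 0 R)) :=
    (hp _ hK).mono_exponent (one_le_two.trans hp2.le)
  refine ⟨memLp_one_iff_integrable.1 (memLp_of_norm_le_rpow le_rfl (by simp) hτ hR hm hBR hdecay),
    (τ - 2) / 2, by linarith, ?_⟩
  have : 0 < (τ - 2) / 2 := by linarith
  have hm' : AEStronglyMeasurable fun y => |B y| * ‖y‖ ^ ((τ - 2) / 2) :=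
    hm.norm.mul (measurable_norm.pow_const _).aestronglyMeasurable
  refine memLp_one_iff_integrable.1 (memLp_of_norm_le_rpow (C := C) (R := R)
    (s := τ - (τ - 2) / 2) le_rfl (by simp) (by linarith) hR hm' ?_ ?_)
  · refine memLp_one_iff_integrable.2 (((memLp_one_iff_integrable.1 hBR).abs.mul_const
      (R ^ ((τ - 2) / 2))).mono' hm'.restrict ?_)
    refine (ae_restrict_iff' hK.measurableSet).2 (Eventually.of_forall fun y hy => ?_)
    have : ‖y‖ ≤ R := by simpa using hy
    rw [norm_of_nonneg (by positivity)]
    gcongr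
  · filter_upwards [hdecay] with y hy hRy
    have hy0 : 0 < ‖y‖ := by linarith
    rw [norm_of_nonneg (by positivity), neg_sub, sub_eq_neg_add _ τ, rpow_add hy0, ← mul_assoc]
    exact mul_le_mul_of_nonneg_right (hy hRy) (by positivity)

/-- Quantitative bounds on a field under which its logarithmic potential is of class `C¹`, with
bounded gradient, and is asymptotic to a multiple of `log |x|`. -/
structure PotentialBounds (B : Plane → ℝ) (δ M : ℝ) : Prop where
  pos : 0 < δ
  le_one : δ ≤ 1
  int : Integrable B
  moment : Integrable fun y => |B y| * ‖y‖ ^ δ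
  kernel : ∀ x, Integrable fun y => |B y| * ‖x - y‖ ^ (-(1 + δ))
  kernel_le : ∀ x, ∫ y, |B y| * ‖x - y‖ ^ (-(1 + δ)) ≤ M

theorem mul_norm_rpow_neg_le {b s q q' : ℝ} (hb : 0 ≤ b) (hs : 0 ≤ s) (hq : q.HolderConjugate q')
    (z : Plane) : b * ‖z‖ ^ (-s) ≤
      b + b ^ q + (Metric.ball 0 1).indicator (fun z : Plane => ‖z‖ ^ (-(s * q'))) z := by
  by_cases hz : z ∈ Metric.ball (0 : Plane) 1
  · have young := young_inequality_of_nonneg hb (rpow_nonneg (norm_nonneg z) (-s)) hq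
    rw [← rpow_mul (norm_nonneg _), neg_mul] at young
    have h₁ : b ^ q / q ≤ b ^ q := div_le_self (by positivity) hq.lt.le
    have h₂ : ‖z‖ ^ (-(s * q')) / q' ≤ ‖z‖ ^ (-(s * q')) :=
      div_le_self (by positivity) hq.symm.lt.le
    rw [indicator_of_mem hz]
    linarith
  · have h : ‖z‖ ^ (-s) ≤ 1 :=
      rpow_le_one_of_one_le_of_nonpos (by simpa using hz) (by linarith)
    rw [indicator_of_notMem hz]
    linarith [mul_le_of_le_one_right hb h, rpow_nonneg hb q]

theorem exists_kernel_bound {s q q' : ℝ} (hs : 0 ≤ s) (hq : q.HolderConjugate q')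
    (hsq : s * q' < 2) (hint : Integrable B) (hB : MemLp B (ENNReal.ofReal q)) :
    (∀ x, Integrable fun y => |B y| * ‖x - y‖ ^ (-s)) ∧
      ∃ M, ∀ x, ∫ y, |B y| * ‖x - y‖ ^ (-s) ≤ M := by
  set K : Plane → ℝ := (Metric.ball 0 1).indicator fun z => ‖z‖ ^ (-(s * q'))
  have hK : Integrable K := integrable_indicator_ball_norm_rpow hsq
  have hBq : Integrable fun y => |B y| ^ q := by
    simpa [ENNReal.toReal_ofReal hq.nonneg] using
      hB.integrable_norm_rpow (by simpa using hq.pos) ENNReal.ofReal_ne_top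
  have hBB : Integrable fun y => |B y| + |B y| ^ q := hint.abs.add hBq
  have hdom : ∀ x, Integrable fun y => |B y| + |B y| ^ q + K (x - y) := fun x =>
    hBB.add (hK.comp_sub_left x)
  have hle : ∀ x y, |B y| * ‖x - y‖ ^ (-s) ≤ |B y| + |B y| ^ q + K (x - y) := fun x y =>
    mul_norm_rpow_neg_le (abs_nonneg (B y)) hs hq (x - y)
  have hi : ∀ x, Integrable fun y => |B y| * ‖x - y‖ ^ (-s) := fun x => by
    refine (hdom x).mono'
      (hint.1.norm.mul (measurable_norm_sub_rpow x _).aestronglyMeasurable)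
      (Eventually.of_forall fun y => ?_)
    rw [norm_of_nonneg (by positivity)]
    exact hle x y
  refine ⟨hi, (∫ y, (|B y| + |B y| ^ q)) + ∫ z, K z, fun x => ?_⟩
  calc ∫ y, |B y| * ‖x - y‖ ^ (-s) ≤ ∫ y, (|B y| + |B y| ^ q + K (x - y)) :=
        integral_mono (hi x) (hdom x) (hle x)
    _ = (∫ y, (|B y| + |B y| ^ q)) + ∫ z, K z := by
        rw [integral_add hBB (hK.comp_sub_left x), integral_sub_left_eq_self]

theorem exists_potentialBounds {q s : ℝ} (hq : 2 < q) (hs : 0 < s) (hint : Integrable B)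
    (hB : MemLp B (ENNReal.ofReal q)) (hmom : Integrable fun y => |B y| * ‖y‖ ^ s) :
    ∃ δ M, PotentialBounds B δ M := by
  set δ := min (min s ((q - 2) / (2 * q))) 1
  have hδ : 0 < δ := lt_min (lt_min hs (div_pos (by linarith) (by linarith))) one_pos
  have hδs : δ ≤ s := (min_le_left _ _).trans (min_le_left _ _)
  have hδq : δ ≤ (q - 2) / (2 * q) := (min_le_left _ _).trans (min_le_right _ _)
  have hexp : (1 + δ) * (q / (q - 1)) < 2 := by
    have : δ * (2 * q) ≤ q - 2 := (le_div_iff₀ (by linarith)).1 hδq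
    rw [← mul_div_assoc, div_lt_iff₀ (by linarith)]
    nlinarith
  obtain ⟨hker, M, hM⟩ := exists_kernel_bound (by linarith)
    (HolderConjugate.conjExponent (by linarith : 1 < q)) hexp hint hB
  refine ⟨δ, M, hδ, min_le_right _ _, hint, ?_, hker, hM⟩
  refine (hint.abs.add hmom).mono'
    (hint.1.norm.mul (measurable_norm.pow_const δ).aestronglyMeasurable)
    (Eventually.of_forall fun y => ?_)
  have hle : ‖y‖ ^ δ ≤ 1 + ‖y‖ ^ s := by
    rcases le_total ‖y‖ 1 with h | h
    · linarith [rpow_le_one (norm_nonneg y) h hδ.le, rpow_nonneg (norm_nonneg y) s]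
    · linarith [rpow_le_rpow_of_exponent_le h hδs]
  rw [norm_of_nonneg (by positivity)]
  refine (mul_le_mul_of_nonneg_left hle (abs_nonneg (B y))).trans_eq ?_
  simp [mul_add]

end Integrability

section Kernels

variable {ε δ : ℝ}

/-- The logarithmic kernel `½ log (|z|² + ε²)`, regularised at length scale `ε`; it is `log |z|`
for `ε = 0`. -/
def logKernel (ε : ℝ) (z : Plane) : ℝ := 1 / 2 * log (‖z‖ ^ 2 + ε ^ 2)

/-- The gradient `z / (|z|² + ε²)` of `logKernel ε`, as a linear form; for `ε = 0` its value at the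
origin is `0`. -/
def gradKernel (ε : ℝ) (z : Plane) : Plane →L[ℝ] ℝ := (‖z‖ ^ 2 + ε ^ 2)⁻¹ • innerSL ℝ z

theorem logKernel_zero (z : Plane) : logKernel 0 z = log ‖z‖ := by
  simp [logKernel, log_pow]

theorem gradKernel_apply (ε : ℝ) (z v : Plane) :
    gradKernel ε z v = (‖z‖ ^ 2 + ε ^ 2)⁻¹ * inner ℝ z v := by
  simp [gradKernel]

theorem norm_gradKernel (ε : ℝ) (z : Plane) :
    ‖gradKernel ε z‖ = (‖z‖ ^ 2 + ε ^ 2)⁻¹ * ‖z‖ := by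
  rw [gradKernel, norm_smul, innerSL_apply_norm, norm_of_nonneg (by positivity)]

theorem norm_gradKernel_le_inv_norm (ε : ℝ) (z : Plane) : ‖gradKernel ε z‖ ≤ ‖z‖⁻¹ := by
  rw [norm_gradKernel]
  rcases (norm_nonneg z).eq_or_lt with hz | hz
  · simp [← hz]
  · calc (‖z‖ ^ 2 + ε ^ 2)⁻¹ * ‖z‖ ≤ (‖z‖ ^ 2)⁻¹ * ‖z‖ := by
          gcongr
          exact le_add_of_nonneg_right (sq_nonneg ε)
      _ = ‖z‖⁻¹ := by field_simp

theorem norm_gradKernel_le_inv (hε : 0 < ε) (z : Plane) : ‖gradKernel ε z‖ ≤ ε⁻¹ := by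
  rw [norm_gradKernel, inv_mul_le_iff₀ (by positivity), ← div_eq_mul_inv, le_div_iff₀ hε]
  nlinarith [sq_nonneg (‖z‖ - ε), sq_nonneg ‖z‖, sq_nonneg ε]

theorem abs_log_le (hδ : 0 < δ) {t : ℝ} (ht : 0 ≤ t) :
    |log t| ≤ t ^ δ / δ + t ^ (-(1 + δ)) / (1 + δ) := by
  have hinv := log_le_rpow_div (inv_nonneg.2 ht) (by linarith : 0 < 1 + δ)
  rw [log_inv, inv_rpow ht, ← rpow_neg ht] at hinv
  have h₁ : 0 ≤ t ^ δ / δ := by positivity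
  have h₂ : 0 ≤ t ^ (-(1 + δ)) / (1 + δ) := by positivity
  exact abs_le.2 ⟨by linarith, by linarith [log_le_rpow_div ht hδ]⟩

theorem inv_le_one_add_rpow (hδ : 0 < δ) {t : ℝ} (ht : 0 ≤ t) : t⁻¹ ≤ 1 + t ^ (-(1 + δ)) := by
  have hnn : 0 ≤ t ^ (-(1 + δ)) := rpow_nonneg ht _
  rcases le_or_gt 1 t with h | h
  · linarith [inv_le_one_of_one_le₀ h]
  rcases ht.eq_or_lt with rfl | h₀
  · rw [inv_zero]
    linarith
  · rw [← rpow_neg_one]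
    linarith [rpow_le_rpow_of_exponent_ge h₀ h.le (by linarith : -(1 + δ) ≤ -1)]

theorem abs_logKernel_sub_le (hε : 0 ≤ ε) {z : Plane} (hz : z ≠ 0) :
    |logKernel ε z - logKernel 0 z| ≤ ε * ‖z‖⁻¹ := by
  have : 0 < ‖z‖ := norm_pos_iff.2 hz
  set u := ε * ‖z‖⁻¹
  have hu : 0 ≤ u := by positivity
  have hdiff : logKernel ε z - logKernel 0 z = 1 / 2 * log (1 + u ^ 2) := by
    have : ‖z‖ ^ 2 + ε ^ 2 = ‖z‖ ^ 2 * (1 + u ^ 2) := by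
      simp only [u]
      field_simp
    rw [logKernel_zero, logKernel, this, log_mul (by positivity) (by positivity), log_pow]
    push_cast
    ring
  have hnn : 0 ≤ log (1 + u ^ 2) := log_nonneg (by nlinarith)
  rw [hdiff, abs_of_nonneg (by positivity)]
  calc 1 / 2 * log (1 + u ^ 2) ≤ 1 / 2 * log ((1 + u) ^ 2) := by
        gcongr
        nlinarith
    _ = log (1 + u) := by
        rw [log_pow]
        push_cast
        ring
    _ ≤ u := by linarith [log_le_sub_one_of_pos (by positivity : 0 < 1 + u)]

theorem sq_div_add_sq_le_rpow (hε : 0 < ε) (hδ : 0 ≤ δ) (hδ2 : δ ≤ 2) {t : ℝ} (ht : 0 < t) :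
    ε ^ 2 / (t ^ 2 + ε ^ 2) ≤ (ε / t) ^ δ := by
  rcases le_or_gt ε t with h | h
  · calc ε ^ 2 / (t ^ 2 + ε ^ 2) ≤ ε ^ 2 / t ^ 2 := by
          gcongr
          exact le_add_of_nonneg_right (sq_nonneg ε)
      _ = (ε / t) ^ (2 : ℝ) := by rw [rpow_two, div_pow]
      _ ≤ (ε / t) ^ δ := rpow_le_rpow_of_exponent_ge (by positivity) ((div_le_one ht).2 h) hδ2
  · exact ((div_le_one (by positivity)).2 (by nlinarith)).trans
      (one_le_rpow ((one_le_div ht).2 h.le) hδ)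

theorem norm_gradKernel_sub_le (hε : 0 < ε) (hδ : 0 ≤ δ) (hδ2 : δ ≤ 2) (z : Plane) :
    ‖gradKernel ε z - gradKernel 0 z‖ ≤ ε ^ δ * ‖z‖ ^ (-(1 + δ)) := by
  rcases (norm_nonneg z).eq_or_lt with hz | hz
  · rw [norm_eq_zero.1 hz.symm]
    simp only [gradKernel, map_zero, smul_zero, sub_zero, norm_zero]
    positivity
  have hdiff : gradKernel ε z - gradKernel 0 z
      = -(ε ^ 2 / (‖z‖ ^ 2 + ε ^ 2) * (‖z‖ ^ 2)⁻¹) • innerSL ℝ z := by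
    refine (sub_smul _ _ _).symm.trans (congrArg (· • innerSL ℝ z) ?_)
    field_simp
    ring
  rw [hdiff, norm_smul, norm_neg, norm_of_nonneg (by positivity), innerSL_apply_norm]
  calc ε ^ 2 / (‖z‖ ^ 2 + ε ^ 2) * (‖z‖ ^ 2)⁻¹ * ‖z‖
      ≤ (ε / ‖z‖) ^ δ * (‖z‖ ^ 2)⁻¹ * ‖z‖ := by
        gcongr
        exact sq_div_add_sq_le_rpow hε hδ hδ2 hz
    _ = ε ^ δ * ‖z‖ ^ (-(1 + δ)) := by
        rw [div_rpow hε.le hz.le, neg_add, rpow_add hz, rpow_neg hz.le, rpow_neg hz.le, rpow_one]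
        field_simp

theorem continuous_gradKernel (hε : 0 < ε) : Continuous (gradKernel ε) := by
  have : Continuous fun z : Plane => (‖z‖ ^ 2 + ε ^ 2)⁻¹ :=
    Continuous.inv₀ (by fun_prop) fun z => by positivity
  exact this.smul (innerSL ℝ (E := Plane)).continuous

@[fun_prop]
theorem measurable_logKernel (ε : ℝ) : Measurable (logKernel ε) := by
  unfold logKernel
  fun_prop

@[fun_prop]
theorem measurable_gradKernel (ε : ℝ) : Measurable (gradKernel ε) := by
  have : Measurable fun z : Plane => (‖z‖ ^ 2 + ε ^ 2)⁻¹ := by fun_prop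
  exact this.smul (innerSL ℝ (E := Plane)).continuous.measurable

theorem hasFDerivAt_logKernel (hε : 0 < ε) (z : Plane) :
    HasFDerivAt (logKernel ε) (gradKernel ε z) z := by
  have hsq : HasFDerivAt (fun z : Plane => ‖z‖ ^ 2 + ε ^ 2) (2 • innerSL ℝ z) z := by
    simpa using (hasFDerivAt_id z).norm_sq.add_const (ε ^ 2)
  refine ((hsq.log (by positivity)).const_mul (1 / 2)).congr_fderiv ?_
  ext v
  simp only [one_div, smul_apply, coe_innerSL_apply, nsmul_eq_mul, Nat.cast_ofNat, smul_eq_mul,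
    gradKernel]
  ring

end Kernels

section Potential

variable {B : Plane → ℝ} {δ M ε : ℝ}

/-- The logarithmic potential of `B` with kernel `logKernel ε`; for `ε = 0` this is `scalarPot B`
without its normalising factor `-(2π)⁻¹`. -/
def logPot (B : Plane → ℝ) (ε : ℝ) (x : Plane) : ℝ := ∫ y, B y * logKernel ε (x - y)

/-- The gradient of `logPot B ε`. -/
def gradPot (B : Plane → ℝ) (ε : ℝ) (x : Plane) : Plane →L[ℝ] ℝ :=
  ∫ y, B y • gradKernel ε (x - y)

theorem norm_mul_logKernel_sub_le (B : Plane → ℝ) (hε : 0 ≤ ε) (x : Plane) :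
    ∀ᵐ y, ‖B y * logKernel ε (x - y) - B y * logKernel 0 (x - y)‖ ≤ ε * (|B y| * ‖x - y‖⁻¹) := by
  filter_upwards [compl_mem_ae_iff.2 (measure_singleton x)] with y hy
  have hxy : x - y ≠ 0 := sub_ne_zero.2 fun h => hy h.symm
  rw [← mul_sub, norm_mul, norm_eq_abs, norm_eq_abs, mul_left_comm]
  exact mul_le_mul_of_nonneg_left (abs_logKernel_sub_le hε hxy) (abs_nonneg _)

theorem norm_smul_gradKernel_le (B : Plane → ℝ) (ε : ℝ) (x y : Plane) :
    ‖B y • gradKernel ε (x - y)‖ ≤ |B y| * ‖x - y‖⁻¹ := by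
  rw [norm_smul, norm_eq_abs]
  exact mul_le_mul_of_nonneg_left (norm_gradKernel_le_inv_norm ε _) (abs_nonneg _)

theorem norm_smul_gradKernel_le_inv (B : Plane → ℝ) (hε : 0 < ε) (x y : Plane) :
    ‖B y • gradKernel ε (x - y)‖ ≤ |B y| * ε⁻¹ := by
  rw [norm_smul, norm_eq_abs]
  exact mul_le_mul_of_nonneg_left (norm_gradKernel_le_inv hε _) (abs_nonneg _)

namespace PotentialBounds

theorem mul_inv_norm_sub_le (h : PotentialBounds B δ M) (x y : Plane) :
    |B y| * ‖x - y‖⁻¹ ≤ |B y| + |B y| * ‖x - y‖ ^ (-(1 + δ)) := by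
  rw [← mul_one_add]
  exact mul_le_mul_of_nonneg_left (inv_le_one_add_rpow h.pos (norm_nonneg _)) (abs_nonneg _)

theorem integrable_inv (h : PotentialBounds B δ M) (x : Plane) :
    Integrable fun y => |B y| * ‖x - y‖⁻¹ := by
  refine (h.int.abs.add (h.kernel x)).mono' (h.int.1.norm.mul ?_)
    (Eventually.of_forall fun y => ?_)
  · exact (measurable_const.sub measurable_id).norm.inv.aestronglyMeasurable
  · rw [norm_of_nonneg (by positivity)]
    exact h.mul_inv_norm_sub_le x y

theorem integral_inv_le (h : PotentialBounds B δ M) (x : Plane) :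
    ∫ y, |B y| * ‖x - y‖⁻¹ ≤ (∫ y, |B y|) + M :=
  calc ∫ y, |B y| * ‖x - y‖⁻¹ ≤ ∫ y, (|B y| + |B y| * ‖x - y‖ ^ (-(1 + δ))) :=
        integral_mono (h.integrable_inv x) (h.int.abs.add (h.kernel x)) (h.mul_inv_norm_sub_le x)
    _ = (∫ y, |B y|) + ∫ y, |B y| * ‖x - y‖ ^ (-(1 + δ)) := integral_add h.int.abs (h.kernel x)
    _ ≤ (∫ y, |B y|) + M := by gcongr; exact h.kernel_le x

theorem integrable_log (h : PotentialBounds B δ M) (x : Plane) :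
    Integrable fun y => B y * log ‖x - y‖ := by
  have hδ := h.pos
  refine ((((h.int.abs.mul_const (‖x‖ ^ δ)).add h.moment).div_const δ).add
    ((h.kernel x).div_const (1 + δ))).mono' (h.int.1.mul ?_) (Eventually.of_forall fun y => ?_)
  · exact (measurable_const.sub measurable_id).norm.log.aestronglyMeasurable
  have hsub : ‖x - y‖ ^ δ ≤ ‖x‖ ^ δ + ‖y‖ ^ δ :=
    (rpow_le_rpow (norm_nonneg _) (norm_sub_le x y) hδ.le).trans
      (rpow_add_le_add_rpow (norm_nonneg _) (norm_nonneg _) hδ.le h.le_one)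
  calc ‖B y * log ‖x - y‖‖
      ≤ |B y| * (‖x - y‖ ^ δ / δ + ‖x - y‖ ^ (-(1 + δ)) / (1 + δ)) := by
        rw [norm_mul, norm_eq_abs, norm_eq_abs]
        exact mul_le_mul_of_nonneg_left (abs_log_le hδ (norm_nonneg _)) (abs_nonneg _)
    _ ≤ |B y| * ((‖x‖ ^ δ + ‖y‖ ^ δ) / δ + ‖x - y‖ ^ (-(1 + δ)) / (1 + δ)) := by gcongr
    _ = _ := by
        simp only [Pi.add_apply]
        ring

theorem integrable_logKernel (h : PotentialBounds B δ M) (hε : 0 ≤ ε) (x : Plane) :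
    Integrable fun y => B y * logKernel ε (x - y) := by
  have hm : ∀ ε, AEStronglyMeasurable fun y => B y * logKernel ε (x - y) := fun ε =>
    h.int.1.mul (by fun_prop : Measurable fun y => logKernel ε (x - y)).aestronglyMeasurable
  have h₀ : Integrable fun y => B y * logKernel 0 (x - y) := by
    simpa only [logKernel_zero] using h.integrable_log x
  have hsub := ((h.integrable_inv x).const_mul ε).mono' ((hm ε).sub (hm 0))
    (norm_mul_logKernel_sub_le B hε x)
  exact (hsub.add h₀).congr (Eventually.of_forall fun y => by simp)

theorem abs_logPot_sub_le (h : PotentialBounds B δ M) (hε : 0 ≤ ε) (x : Plane) :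
    |logPot B ε x - logPot B 0 x| ≤ ε * ((∫ y, |B y|) + M) := by
  rw [logPot, logPot,
    ← integral_sub (h.integrable_logKernel hε x) (h.integrable_logKernel le_rfl x)]
  refine (norm_integral_le_of_norm_le ((h.integrable_inv x).const_mul ε)
    (norm_mul_logKernel_sub_le B hε x)).trans ?_
  rw [integral_const_mul]
  exact mul_le_mul_of_nonneg_left (h.integral_inv_le x) hε

theorem integrable_gradKernel (h : PotentialBounds B δ M) (ε : ℝ) (x : Plane) :
    Integrable fun y => B y • gradKernel ε (x - y) :=
  (h.integrable_inv x).mono' (h.int.1.smul ((measurable_gradKernel ε).comp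
    (measurable_const.sub measurable_id)).aestronglyMeasurable)
    (Eventually.of_forall (norm_smul_gradKernel_le B ε x))

theorem norm_gradPot_le (h : PotentialBounds B δ M) (ε : ℝ) (x : Plane) :
    ‖gradPot B ε x‖ ≤ (∫ y, |B y|) + M :=
  (norm_integral_le_of_norm_le (h.integrable_inv x)
    (Eventually.of_forall (norm_smul_gradKernel_le B ε x))).trans (h.integral_inv_le x)

theorem norm_gradPot_sub_le (h : PotentialBounds B δ M) (hε : 0 < ε) (x : Plane) :
    ‖gradPot B ε x - gradPot B 0 x‖ ≤ ε ^ δ * M := by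
  rw [gradPot, gradPot, ← integral_sub (h.integrable_gradKernel ε x) (h.integrable_gradKernel 0 x)]
  refine (norm_integral_le_of_norm_le ((h.kernel x).const_mul (ε ^ δ))
    (Eventually.of_forall fun y => ?_)).trans ?_
  · have hsub : B y • gradKernel ε (x - y) - B y • gradKernel 0 (x - y)
        = B y • (gradKernel ε (x - y) - gradKernel 0 (x - y)) := (smul_sub _ _ _).symm
    rw [hsub, norm_smul, norm_eq_abs, mul_left_comm]
    exact mul_le_mul_of_nonneg_left
      (norm_gradKernel_sub_le hε h.pos.le (h.le_one.trans one_le_two) _) (abs_nonneg _)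
  · rw [integral_const_mul]
    exact mul_le_mul_of_nonneg_left (h.kernel_le x) (by positivity)

theorem hasFDerivAt_logPot_of_pos (h : PotentialBounds B δ M) (hε : 0 < ε) (x : Plane) :
    HasFDerivAt (logPot B ε) (gradPot B ε x) x := by
  refine hasFDerivAt_integral_of_dominated_of_fderiv_le (bound := fun y => |B y| * ε⁻¹)
    (F' := fun x y => B y • gradKernel ε (x - y)) univ_mem
    (Eventually.of_forall fun x => (h.integrable_logKernel hε.le x).1)
    (h.integrable_logKernel hε.le x) (h.integrable_gradKernel ε x).1
    (Eventually.of_forall fun y x _ => norm_smul_gradKernel_le_inv B hε x y)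
    (h.int.abs.mul_const _) (Eventually.of_forall fun y x _ => ?_)
  simpa using (((hasFDerivAt_logKernel hε (x - y)).comp x
    ((hasFDerivAt_id x).sub_const y)).const_mul (B y))

theorem continuous_gradPot_of_pos (h : PotentialBounds B δ M) (hε : 0 < ε) :
    Continuous (gradPot B ε) :=
  continuous_of_dominated (bound := fun y => |B y| * ε⁻¹)
    (fun x => (h.integrable_gradKernel ε x).1)
    (fun x => Eventually.of_forall fun y => norm_smul_gradKernel_le_inv B hε x y)
    (h.int.abs.mul_const _) (Eventually.of_forall fun y =>
      ((continuous_gradKernel hε).comp (continuous_id.sub continuous_const)).const_smul (B y))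

theorem tendstoUniformly_gradPot (h : PotentialBounds B δ M) :
    TendstoUniformly (fun n : ℕ => gradPot B (1 / ((n : ℝ) + 1))) (gradPot B 0) atTop := by
  have hlim : Tendsto (fun n : ℕ => (1 / ((n : ℝ) + 1)) ^ δ * M) atTop (𝓝 0) := by
    have := (tendsto_one_div_add_atTop_nhds_zero_nat (𝕜 := ℝ)).rpow_const (p := δ)
      (Or.inr h.pos.le)
    rw [zero_rpow h.pos.ne'] at this
    simpa using this.mul_const M
  rw [Metric.tendstoUniformly_iff]
  intro e he
  filter_upwards [hlim.eventually_lt_const he] with n hn x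
  rw [dist_comm, dist_eq_norm]
  exact (h.norm_gradPot_sub_le (by positivity) x).trans_lt hn

theorem continuous_gradPot (h : PotentialBounds B δ M) : Continuous (gradPot B 0) :=
  h.tendstoUniformly_gradPot.continuous
    (Frequently.of_forall fun _ => h.continuous_gradPot_of_pos (by positivity))

theorem hasFDerivAt_logPot (h : PotentialBounds B δ M) (x : Plane) :
    HasFDerivAt (logPot B 0) (gradPot B 0 x) x := by
  refine hasFDerivAt_of_tendstoUniformly h.tendstoUniformly_gradPot
    (fun n x => h.hasFDerivAt_logPot_of_pos (by positivity) x) (fun x => ?_) x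
  rw [tendsto_iff_norm_sub_tendsto_zero]
  refine squeeze_zero (fun _ => norm_nonneg _)
    (fun n => h.abs_logPot_sub_le (ε := 1 / ((n : ℝ) + 1)) (by positivity) x) ?_
  simpa using (tendsto_one_div_add_atTop_nhds_zero_nat (𝕜 := ℝ)).mul_const ((∫ y, |B y|) + M)

theorem hasFDerivAt_scalarPot (h : PotentialBounds B δ M) (x : Plane) :
    HasFDerivAt (scalarPot B) (-(1 / (2 * π)) • gradPot B 0 x) x := by
  have hpot : scalarPot B = fun x => -(1 / (2 * π)) * logPot B 0 x := by
    ext x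
    simp only [scalarPot, logPot, logKernel_zero]
  rw [hpot]
  exact (h.hasFDerivAt_logPot x).const_mul _

theorem partialD_scalarPot (h : PotentialBounds B δ M) (j : Fin 2) (x : Plane) :
    partialD j (scalarPot B) x = -(1 / (2 * π)) * gradPot B 0 x (unitVec j) := by
  rw [partialD, (h.hasFDerivAt_scalarPot x).fderiv, smul_apply, smul_eq_mul]

theorem contDiff_scalarPot (h : PotentialBounds B δ M) : ContDiff ℝ 1 (scalarPot B) :=
  contDiff_one_iff_hasFDerivAt.2
    ⟨_, h.continuous_gradPot.const_smul (-(1 / (2 * π))), h.hasFDerivAt_scalarPot⟩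

theorem exists_abs_partialD_le (h : PotentialBounds B δ M) :
    ∃ A, 0 ≤ A ∧ ∀ j x, |partialD j (scalarPot B) x| ≤ A := by
  refine ⟨1 / (2 * π) * ((∫ y, |B y|) + M), ?_, fun j x => ?_⟩
  · exact mul_nonneg (by positivity) ((norm_nonneg _).trans (h.norm_gradPot_le 0 0))
  · rw [h.partialD_scalarPot, abs_mul, abs_neg, abs_of_pos (by positivity)]
    refine mul_le_mul_of_nonneg_left ?_ (by positivity)
    refine ((gradPot B 0 x).le_opNorm (unitVec j)).trans ?_
    simpa [unitVec] using h.norm_gradPot_le 0 x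

end PotentialBounds

end Potential

section Poisson

variable {B φ : Plane → ℝ} {δ M : ℝ}

-- In polar coordinates the integrand is the radial derivative of `φ`, divided by `r`.
theorem integral_fderiv_radial (hφ : ContDiff ℝ 1 φ) (hc : HasCompactSupport φ) :
    ∫ x, (‖x‖ ^ 2)⁻¹ * fderiv ℝ φ x x = -(2 * π * φ 0) := by
  obtain ⟨R, hR, hsupp⟩ := hc.isCompact.isBounded.subset_ball_lt 0 (0 : Plane)
  have hout : ∀ r t, R ≤ r → polarPoint (r, t) ∉ tsupport φ := fun r t hr hmem => by
    have := hsupp hmem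
    rw [mem_ball_zero_iff, norm_polarPoint, abs_of_pos (hR.trans_le hr)] at this
    linarith
  set F : ℝ → ℝ → ℝ := fun r t => fderiv ℝ φ (polarPoint (r, t)) (radialVec t) with hF
  have hFc : Continuous (Function.uncurry F) :=
    continuous_fderiv_polarPoint_apply hφ continuous_radialVec
  have hder : ∀ r, HasDerivAt (fun s => ∫ t in (-π)..π, φ (polarPoint (s, t)))
      (∫ t in (-π)..π, F r t) r :=
    hasDerivAt_intervalIntegral_of_continuous (hφ.continuous.comp continuous_polarPoint) hFc
      (hasDerivAt_comp_polarPoint_fst hφ)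
  calc ∫ x, (‖x‖ ^ 2)⁻¹ * fderiv ℝ φ x x = ∫ r in (0 : ℝ)..R, ∫ t in (-π)..π, F r t := by
        refine integral_eq_intervalIntegral_polar hR.le hFc.continuousOn (fun r t hr => ?_)
          fun r t hr => ?_
        · rw [norm_polarPoint, abs_of_pos hr]
          nth_rewrite 2 [polarPoint_eq_smul]
          rw [map_smul, smul_eq_mul]
          field_simp
          rfl
        · have : fderiv ℝ φ (polarPoint (r, t)) = 0 := by
            by_contra hne
            exact hout r t hr.le (support_fderiv_subset ℝ hne)
          simp only [hF, this, zero_apply]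
    _ = (∫ t in (-π)..π, φ (polarPoint (R, t))) - ∫ t in (-π)..π, φ (polarPoint (0, t)) :=
        intervalIntegral.integral_eq_sub_of_hasDerivAt (fun r _ => hder r)
          (Continuous.intervalIntegrable
            (intervalIntegral.continuous_parametric_intervalIntegral_of_continuous' hFc _ _) _ _)
    _ = -(2 * π * φ 0) := by
        have hφR : ∀ t, φ (polarPoint (R, t)) = 0 := fun t =>
          image_eq_zero_of_notMem_tsupport (hout R t le_rfl)
        have hφ0 : ∀ t, φ (polarPoint (0, t)) = φ 0 := fun t => by
          rw [polarPoint_eq_smul, zero_smul]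
        simp only [hφR, hφ0, intervalIntegral.integral_const, smul_eq_mul]
        ring

theorem integral_fderiv_radial_sub (hφ : ContDiff ℝ 1 φ) (hc : HasCompactSupport φ) (y : Plane) :
    ∫ x, (‖x - y‖ ^ 2)⁻¹ * fderiv ℝ φ x (x - y) = -(2 * π * φ y) := by
  have htrans := integral_fderiv_radial (φ := fun x => φ (x + y))
    (hφ.comp (contDiff_id.add contDiff_const)) (hc.comp_homeomorph (Homeomorph.addRight y))
  rw [← integral_add_right_eq_self _ y]
  simp only [fderiv_comp_add_right, zero_add, add_sub_cancel_right] at htrans ⊢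
  exact htrans

theorem sum_gradKernel_unitVec_mul (z : Plane) (L : Plane →L[ℝ] ℝ) :
    ∑ j, gradKernel 0 z (unitVec j) * L (unitVec j) = (‖z‖ ^ 2)⁻¹ * L z := by
  have hz : z = ∑ j, z j • unitVec j := by
    ext i
    fin_cases i <;> simp [unitVec]
  have hL : L z = ∑ j, z j * L (unitVec j) := by
    conv_lhs => rw [hz]
    simp only [map_sum, map_smul, smul_eq_mul]
  have hker : ∀ j, gradKernel 0 z (unitVec j) = (‖z‖ ^ 2)⁻¹ * z j := fun j => by
    simp [gradKernel_apply, unitVec, EuclideanSpace.inner_single_right]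
  simp only [hL, hker, Finset.mul_sum, mul_assoc]

namespace PotentialBounds

theorem integrable_prod_kernel (h : PotentialBounds B δ M) (hφ : ContDiff ℝ 1 φ)
    (hc : HasCompactSupport φ) :
    Integrable (Function.uncurry fun x y => B y * ((‖x - y‖ ^ 2)⁻¹ * fderiv ℝ φ x (x - y)))
      (volume.prod volume) := by
  have hφ' : Continuous (fderiv ℝ φ) := hφ.continuous_fderiv one_ne_zero
  have hker : Measurable fun p : Plane × Plane =>
      (‖p.1 - p.2‖ ^ 2)⁻¹ * fderiv ℝ φ p.1 (p.1 - p.2) := by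
    have hnum : Continuous fun p : Plane × Plane => fderiv ℝ φ p.1 (p.1 - p.2) :=
      (hφ'.comp continuous_fst).clm_apply (continuous_fst.sub continuous_snd)
    exact (by fun_prop : Measurable fun p : Plane × Plane => (‖p.1 - p.2‖ ^ 2)⁻¹).mul
      hnum.measurable
  have hbound : ∀ x y, ‖B y * ((‖x - y‖ ^ 2)⁻¹ * fderiv ℝ φ x (x - y))‖
      ≤ ‖fderiv ℝ φ x‖ * (|B y| * ‖x - y‖⁻¹) := fun x y => by
    rw [norm_mul, norm_mul, norm_eq_abs, norm_of_nonneg (by positivity)]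
    rcases eq_or_ne ‖x - y‖ 0 with h0 | h0
    · simp [h0]
    · calc |B y| * ((‖x - y‖ ^ 2)⁻¹ * ‖fderiv ℝ φ x (x - y)‖)
          ≤ |B y| * ((‖x - y‖ ^ 2)⁻¹ * (‖fderiv ℝ φ x‖ * ‖x - y‖)) := by
            gcongr
            exact (fderiv ℝ φ x).le_opNorm (x - y)
        _ = _ := by field_simp
  have hm := h.int.1.comp_snd (μ := volume (α := Plane)) |>.mul hker.aestronglyMeasurable
  refine (integrable_prod_iff hm).2 ⟨Eventually.of_forall fun x => ?_, ?_⟩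
  · exact ((h.integrable_inv x).const_mul ‖fderiv ℝ φ x‖).mono'
      (h.int.1.mul (hker.comp measurable_prodMk_left).aestronglyMeasurable)
      (Eventually.of_forall (hbound x))
  · refine ((hφ'.integrable_of_hasCompactSupport (hc.fderiv ℝ)).norm.mul_const
      ((∫ y, |B y|) + M)).mono' hm.norm.integral_prod_right' (Eventually.of_forall fun x => ?_)
    rw [norm_of_nonneg (integral_nonneg fun _ => norm_nonneg _)]
    refine (integral_mono_of_nonneg (Eventually.of_forall fun _ => norm_nonneg _)
      ((h.integrable_inv x).const_mul ‖fderiv ℝ φ x‖) (Eventually.of_forall (hbound x))).trans ?_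
    rw [integral_const_mul]
    exact mul_le_mul_of_nonneg_left (h.integral_inv_le x) (norm_nonneg _)

theorem sum_gradPot_mul_partialD (h : PotentialBounds B δ M) (φ : Plane → ℝ) (x : Plane) :
    ∑ j, gradPot B 0 x (unitVec j) * partialD j φ x
      = ∫ y, B y * ((‖x - y‖ ^ 2)⁻¹ * fderiv ℝ φ x (x - y)) := by
  have hg := h.integrable_gradKernel 0 x
  have hj : ∀ j, Integrable fun y => B y * (gradKernel 0 (x - y) (unitVec j) * partialD j φ x) :=
    fun j => (((ContinuousLinearMap.apply ℝ ℝ (unitVec j)).integrable_comp hg).mul_const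
      (partialD j φ x)).congr (Eventually.of_forall fun y => by simp [mul_assoc])
  calc ∑ j, gradPot B 0 x (unitVec j) * partialD j φ x
      = ∑ j, ∫ y, B y * (gradKernel 0 (x - y) (unitVec j) * partialD j φ x) := by
        refine Finset.sum_congr rfl fun j _ => ?_
        rw [gradPot, ContinuousLinearMap.integral_apply hg, ← integral_mul_const]
        simp only [smul_apply, smul_eq_mul, mul_assoc]
    _ = ∫ y, ∑ j, B y * (gradKernel 0 (x - y) (unitVec j) * partialD j φ x) :=
        (integral_finsetSum _ fun j _ => hj j).symm
    _ = ∫ y, B y * ((‖x - y‖ ^ 2)⁻¹ * fderiv ℝ φ x (x - y)) := by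
        simp only [← Finset.mul_sum, partialD, sum_gradKernel_unitVec_mul]

-- The equation `-Δ h = B` in weak form.
theorem integral_partialD_mul (h : PotentialBounds B δ M) (hφ : ContDiff ℝ 1 φ)
    (hc : HasCompactSupport φ) :
    ∫ x, ∑ j, partialD j (scalarPot B) x * partialD j φ x = ∫ y, B y * φ y :=
  calc ∫ x, ∑ j, partialD j (scalarPot B) x * partialD j φ x
      = -(1 / (2 * π)) * ∫ x, ∫ y, B y * ((‖x - y‖ ^ 2)⁻¹ * fderiv ℝ φ x (x - y)) := by
        simp only [h.partialD_scalarPot, mul_assoc, ← Finset.mul_sum, h.sum_gradPot_mul_partialD,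
          integral_const_mul]
    _ = -(1 / (2 * π)) * ∫ y, ∫ x, B y * ((‖x - y‖ ^ 2)⁻¹ * fderiv ℝ φ x (x - y)) := by
        rw [integral_integral_swap (h.integrable_prod_kernel hφ hc)]
    _ = ∫ y, B y * φ y := by
        simp only [integral_const_mul, integral_fderiv_radial_sub hφ hc]
        rw [← integral_const_mul]
        congr with y
        field_simp

end PotentialBounds

end Poisson

section ConvergenceInL2

variable {α E : Type*} [MeasurableSpace α] {μ : Measure α} [NormedAddCommGroup E]

/-- `F n → f` in `L²(μ)`. It is phrased with functions rather than with classes in `Lp`, because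
the approximating functions will have to be differentiated. -/
structure TendstoL2 (μ : Measure α) (F : ℕ → α → E) (f : α → E) : Prop where
  memLp : ∀ n, MemLp (F n) 2 μ
  memLp_limit : MemLp f 2 μ
  tendsto_eLpNorm : Tendsto (fun n => eLpNorm (F n - f) 2 μ) atTop (𝓝 0)

theorem eLpNorm_two_eq_ofReal_sqrt {f : α → E} (hf : MemLp f 2 μ) :
    eLpNorm f 2 μ = ENNReal.ofReal √(∫ x, ‖f x‖ ^ 2 ∂μ) := by
  rw [hf.eLpNorm_eq_integral_rpow_norm two_ne_zero ENNReal.ofNat_ne_top, sqrt_eq_rpow]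
  simp only [ENNReal.toReal_ofNat, rpow_two, one_div]

namespace TendstoL2

variable {F G : ℕ → α → E} {f g : α → E}

theorem add (hF : TendstoL2 μ F f) (hG : TendstoL2 μ G g) :
    TendstoL2 μ (fun n => F n + G n) (f + g) where
  memLp n := (hF.memLp n).add (hG.memLp n)
  memLp_limit := hF.memLp_limit.add hG.memLp_limit
  tendsto_eLpNorm := by
    refine tendsto_of_tendsto_of_tendsto_of_le_of_le tendsto_const_nhds
      (by simpa only [add_zero] using hF.tendsto_eLpNorm.add hG.tendsto_eLpNorm)
      (fun _ => zero_le) fun n => ?_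
    rw [add_sub_add_comm]
    exact eLpNorm_add_le ((hF.memLp n).sub hF.memLp_limit).1 ((hG.memLp n).sub hG.memLp_limit).1
      one_le_two

theorem exists_subseq_ae (hF : TendstoL2 μ F f) :
    ∃ s : ℕ → ℕ, StrictMono s ∧ ∀ᵐ x ∂μ, Tendsto (fun k => F (s k) x) atTop (𝓝 (f x)) :=
  (tendstoInMeasure_of_tendsto_eLpNorm two_ne_zero (fun n => (hF.memLp n).1) hF.memLp_limit.1
    hF.tendsto_eLpNorm).exists_seq_tendsto_ae

end TendstoL2

variable {𝕜 : Type*} [NormedField 𝕜] [NormedSpace 𝕜 E]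

theorem memLp_smul_of_norm_le {f : α → E} (hf : MemLp f 2 μ) {a : α → 𝕜} {A : ℝ}
    (ha : AEStronglyMeasurable a μ) (hA : ∀ x, ‖a x‖ ≤ A) : MemLp (fun x => a x • f x) 2 μ :=
  hf.of_le_mul (ha.smul hf.1) (Eventually.of_forall fun x => by
    rw [norm_smul]
    gcongr
    exact hA x)

theorem TendstoL2.smul_of_norm_le {F : ℕ → α → E} {f : α → E} (hF : TendstoL2 μ F f)
    {a : α → 𝕜} {A : ℝ} (ha : AEStronglyMeasurable a μ) (hA : ∀ x, ‖a x‖ ≤ A) :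
    TendstoL2 μ (fun n x => a x • F n x) (fun x => a x • f x) where
  memLp n := memLp_smul_of_norm_le (hF.memLp n) ha hA
  memLp_limit := memLp_smul_of_norm_le hF.memLp_limit ha hA
  tendsto_eLpNorm := by
    have hle : ∀ n, eLpNorm ((fun x => a x • F n x) - fun x => a x • f x) 2 μ
        ≤ ENNReal.ofReal A * eLpNorm (F n - f) 2 μ := fun n =>
      eLpNorm_le_mul_eLpNorm_of_ae_le_mul (Eventually.of_forall fun x => by
        rw [Pi.sub_apply, Pi.sub_apply, ← smul_sub, norm_smul]
        gcongr
        exact hA x) 2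
    refine tendsto_of_tendsto_of_tendsto_of_le_of_le tendsto_const_nhds ?_ (fun _ => zero_le) hle
    simpa only [mul_zero] using
      ENNReal.Tendsto.const_mul hF.tendsto_eLpNorm (.inr ENNReal.ofReal_ne_top)

theorem tendstoL2_smul_of_dominated {f : α → E} (hf : MemLp f 2 μ) {a : ℕ → α → 𝕜} {b : α → 𝕜}
    {A : ℝ} (ha : ∀ n, AEStronglyMeasurable (a n) μ) (hb : AEStronglyMeasurable b μ)
    (hA : ∀ n x, ‖a n x‖ ≤ A) (hlim : ∀ x, Tendsto (fun n => a n x) atTop (𝓝 (b x))) :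
    TendstoL2 μ (fun n x => a n x • f x) (fun x => b x • f x) := by
  have hbA : ∀ x, ‖b x‖ ≤ A := fun x =>
    le_of_tendsto (hlim x).norm (Eventually.of_forall fun n => hA n x)
  have hmem := fun n => memLp_smul_of_norm_le hf (ha n) (hA n)
  have hmem_lim := memLp_smul_of_norm_le hf hb hbA
  refine ⟨hmem, hmem_lim, ?_⟩
  have hint : Tendsto (fun n => ∫ x, ‖a n x • f x - b x • f x‖ ^ 2 ∂μ) atTop
      (𝓝 (∫ _, (0 : ℝ) ∂μ)) := by
    refine tendsto_integral_of_dominated_convergence (fun x => (A + A) ^ 2 * ‖f x‖ ^ 2)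
      (fun n => ((hmem n).sub hmem_lim).1.norm.pow 2)
      (((memLp_two_iff_integrable_sq_norm hf.1).1 hf).const_mul _)
      (fun n => Eventually.of_forall fun x => ?_) (Eventually.of_forall fun x => ?_)
    · rw [norm_pow, norm_norm, ← sub_smul, norm_smul, mul_pow]
      gcongr
      exact (norm_sub_le _ _).trans (add_le_add (hA n x) (hbA x))
    · simpa only [sub_self, norm_zero, zero_pow two_ne_zero] using
        (((hlim x).smul_const (f x)).sub_const (b x • f x)).norm.pow 2
  simp only [fun n => eLpNorm_two_eq_ofReal_sqrt ((hmem n).sub hmem_lim)]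
  simpa only [Pi.sub_apply, integral_zero, sqrt_zero, ENNReal.ofReal_zero] using
    ENNReal.tendsto_ofReal hint.sqrt

-- The multiplication operator by `a` is closed, even when `a` is unbounded.
theorem TendstoL2.smul_of_cauchy {F : ℕ → α → E} {f : α → E} (hF : TendstoL2 μ F f)
    {a : α → 𝕜} (ha : AEStronglyMeasurable a μ) (haF : ∀ n, MemLp (fun x => a x • F n x) 2 μ)
    {b : ℕ → ℝ≥0∞} (hb : Tendsto b atTop (𝓝 0))
    (hcauchy : ∀ n m, eLpNorm (fun x => a x • (F n x - F m x)) 2 μ ≤ b n + b m) :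
    TendstoL2 μ (fun n x => a x • F n x) (fun x => a x • f x) := by
  obtain ⟨s, hs, hae⟩ := hF.exists_subseq_ae
  have hle : ∀ n, eLpNorm ((fun x => a x • F n x) - fun x => a x • f x) 2 μ ≤ b n := fun n => by
    have hfatou := Lp.eLpNorm_lim_le_liminf_eLpNorm (p := 2) (μ := μ)
      (f := fun k x => a x • (F n x - F (s k) x))
      (fun k => ha.smul ((hF.memLp n).sub (hF.memLp (s k))).1)
      ((fun x => a x • F n x) - fun x => a x • f x) (by
        filter_upwards [hae] with x hx
        rw [Pi.sub_apply, ← smul_sub]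
        exact (hx.const_sub (F n x)).const_smul (a x))
    have hlim : Tendsto (fun k => b n + b (s k)) atTop (𝓝 (b n)) := by
      simpa only [add_zero, Function.comp_def] using (hb.comp hs.tendsto_atTop).const_add (b n)
    calc _ ≤ _ := hfatou
      _ ≤ liminf (fun k => b n + b (s k)) atTop :=
          liminf_le_liminf (Eventually.of_forall fun k => hcauchy n (s k))
      _ = b n := hlim.liminf_eq
  have hmem : MemLp (fun x => a x • f x) 2 μ := by
    obtain ⟨n, hn⟩ := (hb.eventually_lt_const ENNReal.zero_lt_top).exists
    have hdiff : MemLp ((fun x => a x • F n x) - fun x => a x • f x) 2 μ :=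
      ⟨(haF n).1.sub (ha.smul hF.memLp_limit.1), (hle n).trans_lt hn⟩
    simpa only [sub_sub_cancel] using (haF n).sub hdiff
  exact ⟨haF, hmem, tendsto_of_tendsto_of_tendsto_of_le_of_le tendsto_const_nhds hb
    (fun _ => zero_le) hle⟩

end ConvergenceInL2

section InnerProduct

variable {α E : Type*} [MeasurableSpace α] {μ : Measure α} [NormedAddCommGroup E]
  [InnerProductSpace ℝ E] {F G : ℕ → α → E} {f g : α → E}

theorem TendstoL2.tendsto_integral_inner (hF : TendstoL2 μ F f) (hG : TendstoL2 μ G g) :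
    Tendsto (fun n => ∫ x, inner ℝ (F n x) (G n x) ∂μ) atTop (𝓝 (∫ x, inner ℝ (f x) (g x) ∂μ)) := by
  have key : ∀ {u v : α → E} (hu : MemLp u 2 μ) (hv : MemLp v 2 μ),
      ∫ x, inner ℝ (u x) (v x) ∂μ = inner ℝ (hu.toLp u) (hv.toLp v) := fun hu hv => by
    rw [L2.inner_def]
    refine integral_congr_ae ?_
    filter_upwards [hu.coeFn_toLp, hv.coeFn_toLp] with x hx hy
    rw [hx, hy]
  simp only [fun n => key (hF.memLp n) (hG.memLp n), key hF.memLp_limit hG.memLp_limit]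
  exact ((Lp.tendsto_Lp_iff_tendsto_eLpNorm'' _ hF.memLp _ hF.memLp_limit).2
    hF.tendsto_eLpNorm).inner
    ((Lp.tendsto_Lp_iff_tendsto_eLpNorm'' _ hG.memLp _ hG.memLp_limit).2 hG.tendsto_eLpNorm)

theorem TendstoL2.tendsto_integral_norm_sq (hF : TendstoL2 μ F f) :
    Tendsto (fun n => ∫ x, ‖F n x‖ ^ 2 ∂μ) atTop (𝓝 (∫ x, ‖f x‖ ^ 2 ∂μ)) := by
  simpa only [real_inner_self_eq_norm_sq] using hF.tendsto_integral_inner hF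

theorem TendstoL2.tendsto_integral_mul_norm_sq (hF : TendstoL2 μ F f) {a : α → ℝ} {A : ℝ}
    (ha : AEStronglyMeasurable a μ) (hA : ∀ x, ‖a x‖ ≤ A) :
    Tendsto (fun n => ∫ x, a x * ‖F n x‖ ^ 2 ∂μ) atTop (𝓝 (∫ x, a x * ‖f x‖ ^ 2 ∂μ)) := by
  simpa only [real_inner_smul_left, real_inner_self_eq_norm_sq] using
    (hF.smul_of_norm_le ha hA).tendsto_integral_inner hF

end InnerProduct

section Mollification

open scoped Convolution

variable {G E : Type*} [NormedAddCommGroup E] [NormedSpace ℝ E]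

theorem eLpNorm_integral_comp_sub_le [AddGroup G] [MeasurableSpace G] [MeasurableAdd₂ G]
    [MeasurableNeg G] {μ ν : Measure G} [SFinite μ] [μ.IsAddRightInvariant]
    [IsProbabilityMeasure ν] {p : ℝ≥0∞} (hp : 1 ≤ p) (hp' : p ≠ ⊤) {f : G → E}
    (hf : AEStronglyMeasurable f μ) :
    eLpNorm (fun x => ∫ t, f (x - t) ∂ν) p μ ≤ eLpNorm f p μ := by
  have hp0 : p ≠ 0 := (one_pos.trans_le hp).ne'
  have hprod : AEStronglyMeasurable (fun z : G × G => f (z.1 - z.2)) (μ.prod ν) :=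
    hf.comp_quasiMeasurePreserving (quasiMeasurePreserving_sub_of_right_invariant μ ν)
  have hpow : AEMeasurable (fun z : G × G => ‖f (z.1 - z.2)‖ₑ ^ p.toReal) (μ.prod ν) :=
    hprod.enorm.pow_const _
  have hpt : ∀ᵐ x ∂μ, ‖∫ t, f (x - t) ∂ν‖ₑ ^ p.toReal ≤ ∫⁻ t, ‖f (x - t)‖ₑ ^ p.toReal ∂ν := by
    filter_upwards [hprod.prodMk_left] with x hx
    have hjensen : ‖∫ t, f (x - t) ∂ν‖ₑ ≤ eLpNorm (fun t => f (x - t)) p ν :=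
      (enorm_integral_le_lintegral_enorm _).trans (eLpNorm_one_eq_lintegral_enorm.symm.trans_le
        (eLpNorm_le_eLpNorm_of_exponent_le hp hx))
    rw [eLpNorm_eq_lintegral_rpow_enorm_toReal hp0 hp', one_div] at hjensen
    exact (ENNReal.le_rpow_inv_iff (ENNReal.toReal_pos hp0 hp')).1 hjensen
  rw [eLpNorm_eq_lintegral_rpow_enorm_toReal hp0 hp',
    eLpNorm_eq_lintegral_rpow_enorm_toReal hp0 hp']
  gcongr ?_ ^ _
  calc ∫⁻ x, ‖∫ t, f (x - t) ∂ν‖ₑ ^ p.toReal ∂μ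
      ≤ ∫⁻ x, ∫⁻ t, ‖f (x - t)‖ₑ ^ p.toReal ∂ν ∂μ := lintegral_mono_ae hpt
    _ = ∫⁻ t, ∫⁻ x, ‖f (x - t)‖ₑ ^ p.toReal ∂μ ∂ν := lintegral_lintegral_swap hpow
    _ = ∫⁻ x, ‖f x‖ₑ ^ p.toReal ∂μ := by
      simp only [lintegral_sub_right_eq_self (fun x => ‖f x‖ₑ ^ p.toReal), lintegral_const,
        measure_univ, mul_one]

variable [NormedAddCommGroup G] [NormedSpace ℝ G] [HasContDiffBump G] [FiniteDimensional ℝ G]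
  [MeasurableSpace G] [BorelSpace G] {μ : Measure G} [μ.IsAddHaarMeasure]

/-- The mollification of `f` by a smooth bump function of integral one. -/
def mollify (μ : Measure G) (φ : ContDiffBump (0 : G)) (f : G → E) : G → E :=
  φ.normed μ ⋆[ContinuousLinearMap.lsmul ℝ ℝ, μ] f

variable {φ : ContDiffBump (0 : G)} {p : ℝ≥0∞} {f : G → E}

theorem eLpNorm_mollify_le (hp : 1 ≤ p) (hp' : p ≠ ⊤) (hf : AEStronglyMeasurable f μ) :
    eLpNorm (mollify μ φ f) p μ ≤ eLpNorm f p μ := by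
  let ν := μ.withDensity fun t => ENNReal.ofReal (φ.normed μ t)
  have hmeas : Measurable fun t => ENNReal.ofReal (φ.normed μ t) :=
    φ.continuous_normed.measurable.ennreal_ofReal
  have : IsProbabilityMeasure ν := ⟨by
    rw [withDensity_apply _ .univ, Measure.restrict_univ, ← ofReal_integral_eq_lintegral_ofReal
      φ.integrable_normed (Eventually.of_forall φ.nonneg_normed), φ.integral_normed,
      ENNReal.ofReal_one]⟩
  refine le_of_eq_of_le ?_ (eLpNorm_integral_comp_sub_le (ν := ν) hp hp' hf)
  congr 1
  ext x
  rw [integral_withDensity_eq_integral_toReal_smul hmeas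
    (Eventually.of_forall fun _ => ENNReal.ofReal_lt_top)]
  simp only [ENNReal.toReal_ofReal (φ.nonneg_normed _)]
  rfl

theorem contDiff_mollify [CompleteSpace E] (hf : LocallyIntegrable f μ) :
    ContDiff ℝ ∞ (mollify μ φ f) :=
  φ.hasCompactSupport_normed.contDiff_convolution_left (n := ⊤) _ φ.contDiff_normed hf

theorem mollify_sub {g : G → E} (hf : LocallyIntegrable f μ) (hg : LocallyIntegrable g μ) :
    mollify μ φ (f - g) = mollify μ φ f - mollify μ φ g := by
  have hexists : ∀ {u : G → E}, LocallyIntegrable u μ →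
      ConvolutionExists (φ.normed μ) u (ContinuousLinearMap.lsmul ℝ ℝ) μ := fun hu =>
    φ.hasCompactSupport_normed.convolutionExists_left _ φ.continuous_normed hu
  ext x
  simp only [mollify, convolution, Pi.sub_apply, map_sub]
  exact integral_sub (hexists hf x) (hexists hg x)

theorem norm_mollify_sub_le_indicator [CompleteSpace E] {g : G → E} (hg : Continuous g) {δ ε : ℝ}
    (hδ : ∀ x y, dist x y < δ → dist (g x) (g y) ≤ ε) (hφδ : φ.rOut ≤ δ) (hφ : φ.rOut ≤ 1) (x : G) :
    ‖mollify μ φ g x - g x‖ ≤ (Metric.cthickening 1 (tsupport g)).indicator (fun _ => ε) x := by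
  rw [← dist_eq_norm]
  refine φ.dist_normed_convolution_le hg.aestronglyMeasurable fun y hy => ?_
  by_cases hx : x ∈ Metric.cthickening 1 (tsupport g)
  · rw [indicator_of_mem hx]
    exact hδ y x ((Metric.mem_ball.1 hy).trans_le hφδ)
  · have hzero : ∀ z, dist x z ≤ 1 → g z = 0 := fun z hz => by
      by_contra hgz
      exact hx (Metric.mem_cthickening_of_dist_le x z 1 _ (subset_tsupport g hgz) hz)
    rw [indicator_of_notMem hx, hzero x (by simp), hzero y, dist_self]
    exact (dist_comm x y).trans_le ((Metric.mem_ball.1 hy).le.trans hφ)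

variable {ι : Type*} {l : Filter ι} {ψ : ι → ContDiffBump (0 : G)}

theorem tendsto_eLpNorm_mollify_sub_of_continuous [CompleteSpace E] (hp : p ≠ 0) (hp' : p ≠ ⊤)
    {g : G → E} (hψ : Tendsto (fun i => (ψ i).rOut) l (𝓝 0)) (hg : Continuous g)
    (hgc : HasCompactSupport g) :
    Tendsto (fun i => eLpNorm (mollify μ (ψ i) g - g) p μ) l (𝓝 0) := by
  set K := Metric.cthickening 1 (tsupport g)
  have hK : IsCompact K := IsCompact.cthickening hgc
  have hμK : μ K ^ (1 / p.toReal) ≠ ⊤ :=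
    ENNReal.rpow_ne_top_of_nonneg (by positivity) hK.measure_lt_top.ne
  refine ENNReal.tendsto_nhds_zero.2 fun ε hε => ?_
  obtain ⟨η, hη, hηε⟩ := ENNReal.exists_nnreal_pos_mul_lt hμK hε.ne'
  obtain ⟨δ, hδ, hgδ⟩ := Metric.uniformContinuous_iff.1
    (hgc.uniformContinuous_of_continuous hg) η (NNReal.coe_pos.2 hη)
  filter_upwards [hψ.eventually_le_const hδ, hψ.eventually_le_const one_pos] with i hi hi1
  calc eLpNorm (mollify μ (ψ i) g - g) p μ
      ≤ eLpNorm (K.indicator fun _ => (η : ℝ)) p μ := eLpNorm_mono_real fun x =>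
        norm_mollify_sub_le_indicator hg (fun _ _ hxy => (hgδ hxy).le) hi hi1 x
    _ = η * μ K ^ (1 / p.toReal) := by
        rw [eLpNorm_indicator_const hK.measurableSet hp hp', enorm_eq_nnnorm, NNReal.nnnorm_eq]
    _ ≤ ε := hηε.le

theorem tendsto_eLpNorm_mollify_sub [CompleteSpace E] (hp : 1 ≤ p) (hp' : p ≠ ⊤)
    (hψ : Tendsto (fun i => (ψ i).rOut) l (𝓝 0)) (hf : MemLp f p μ) :
    Tendsto (fun i => eLpNorm (mollify μ (ψ i) f - f) p μ) l (𝓝 0) := by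
  refine ENNReal.tendsto_nhds_zero.2 fun ε hε => ?_
  obtain ⟨g, hgc, hfg, hg, hgLp⟩ := hf.exists_hasCompactSupport_eLpNorm_sub_le hp'
    (ENNReal.div_pos hε.ne' (ENNReal.ofNat_ne_top (n := 3))).ne'
  have hdiff := (hf.sub hgLp).1
  have hcont := tendsto_eLpNorm_mollify_sub_of_continuous (μ := μ) (one_pos.trans_le hp).ne' hp'
    hψ hg hgc
  filter_upwards [ENNReal.tendsto_nhds_zero.1 hcont _
    (ENNReal.div_pos hε.ne' (ENNReal.ofNat_ne_top (n := 3)))] with i hi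
  have hmollify : ∀ {u : G → E}, LocallyIntegrable u μ →
      AEStronglyMeasurable (mollify μ (ψ i) u) μ := fun hu =>
    (contDiff_mollify hu).continuous.aestronglyMeasurable
  have hfloc := hf.locallyIntegrable hp
  have hgloc := hgLp.locallyIntegrable hp
  calc eLpNorm (mollify μ (ψ i) f - f) p μ
      = eLpNorm (mollify μ (ψ i) (f - g) + ((mollify μ (ψ i) g - g) - (f - g))) p μ := by
        rw [mollify_sub hfloc hgloc]
        congr 1
        abel
    _ ≤ eLpNorm (mollify μ (ψ i) (f - g)) p μ
          + (eLpNorm (mollify μ (ψ i) g - g) p μ + eLpNorm (f - g) p μ) := by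
        have hgdiff := (hmollify hgloc).sub hgLp.1
        refine (eLpNorm_add_le (hmollify (hfloc.sub hgloc)) (hgdiff.sub hdiff) hp).trans ?_
        gcongr
        exact eLpNorm_sub_le hgdiff hdiff hp
    _ ≤ ε / 3 + (ε / 3 + ε / 3) := by
        gcongr
        exact (eLpNorm_mollify_le hp hp' hdiff).trans hfg
    _ = ε := by rw [← add_assoc, ENNReal.add_thirds]

end Mollification

section TestFunctions

/-- Complex test functions on the plane: smooth functions of compact support. -/
structure IsTestFunction (φ : Plane → ℂ) : Prop where
  contDiff : ContDiff ℝ ∞ φ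
  hasCompactSupport : HasCompactSupport φ

namespace IsTestFunction

variable {φ ψ : Plane → ℂ}

theorem continuous (hφ : IsTestFunction φ) : Continuous φ := hφ.contDiff.continuous

theorem contDiff_one (hφ : IsTestFunction φ) : ContDiff ℝ 1 φ :=
  hφ.contDiff.of_le (mod_cast le_top)

theorem differentiable (hφ : IsTestFunction φ) : Differentiable ℝ φ :=
  hφ.contDiff_one.differentiable one_ne_zero

theorem memLp (hφ : IsTestFunction φ) {p : ℝ≥0∞} : MemLp φ p volume :=
  hφ.continuous.memLp_of_hasCompactSupport hφ.hasCompactSupport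

theorem integrable_norm_sq (hφ : IsTestFunction φ) : Integrable fun x => ‖φ x‖ ^ 2 :=
  (memLp_two_iff_integrable_sq_norm hφ.continuous.aestronglyMeasurable).1 hφ.memLp

theorem partialC (hφ : IsTestFunction φ) (j : Fin 2) : IsTestFunction (partialC j φ) where
  contDiff := (hφ.contDiff.fderiv_right (m := ∞) (by norm_cast)).clm_apply contDiff_const
  hasCompactSupport := hφ.hasCompactSupport.fderiv_apply ℝ _

theorem sub (hφ : IsTestFunction φ) (hψ : IsTestFunction ψ) : IsTestFunction (φ - ψ) where
  contDiff := hφ.contDiff.sub hψ.contDiff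
  hasCompactSupport := hφ.hasCompactSupport.sub hψ.hasCompactSupport

theorem partialC_sub (hφ : IsTestFunction φ) (hψ : IsTestFunction ψ) (j : Fin 2) :
    PauliHardy.partialC j (φ - ψ) = PauliHardy.partialC j φ - PauliHardy.partialC j ψ := by
  ext x
  simp only [PauliHardy.partialC, Pi.sub_apply, fderiv_sub (hφ.differentiable x)
    (hψ.differentiable x), sub_apply]

end IsTestFunction

theorem continuous_partialD {f : Plane → ℝ} (hf : ContDiff ℝ 1 f) (j : Fin 2) :
    Continuous (partialD j f) :=
  (hf.continuous_fderiv one_ne_zero).clm_apply continuous_const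

end TestFunctions

section SobolevNorm

/-- A norm for pairs of a function `f` and a would-be gradient `g`; on pairs `(f, ∇f)` it is
equivalent to the norm of `H¹`. Keeping `g` separate lets it measure weak derivatives too. -/
def sobolevNorm (f : Plane → ℂ) (g : Fin 2 → Plane → ℂ) : ℝ≥0∞ :=
  eLpNorm f 2 volume + ∑ j, eLpNorm (g j) 2 volume

variable {ι : Type*} {l : Filter ι}

theorem sobolevNorm_add_le {f f' : Plane → ℂ} {g g' : Fin 2 → Plane → ℂ}
    (hf : AEStronglyMeasurable f volume) (hf' : AEStronglyMeasurable f' volume)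
    (hg : ∀ j, AEStronglyMeasurable (g j) volume) (hg' : ∀ j, AEStronglyMeasurable (g' j) volume) :
    sobolevNorm (f + f') (g + g') ≤ sobolevNorm f g + sobolevNorm f' g' := by
  rw [sobolevNorm, sobolevNorm, sobolevNorm, add_add_add_comm, ← Finset.sum_add_distrib]
  gcongr with j
  · exact eLpNorm_add_le hf hf' one_le_two
  · exact eLpNorm_add_le (hg j) (hg' j) one_le_two

theorem sobolevNorm_neg (f : Plane → ℂ) (g : Fin 2 → Plane → ℂ) :
    sobolevNorm (-f) (-g) = sobolevNorm f g := by
  simp only [sobolevNorm, Pi.neg_apply, eLpNorm_neg]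

theorem tendsto_sobolevNorm_zero {f : ι → Plane → ℂ} {g : ι → Fin 2 → Plane → ℂ}
    (hf : Tendsto (fun i => eLpNorm (f i) 2 volume) l (𝓝 0))
    (hg : ∀ j, Tendsto (fun i => eLpNorm (g i j) 2 volume) l (𝓝 0)) :
    Tendsto (fun i => sobolevNorm (f i) (g i)) l (𝓝 0) := by
  simpa only [sobolevNorm, Finset.sum_const_zero, add_zero] using
    hf.add (tendsto_finsetSum _ fun j _ => hg j)

end SobolevNorm

section MollifiedDerivative

variable {u w : Plane → ℂ} {j : Fin 2}

theorem partialC_mollify_eq_integral (φ : ContDiffBump (0 : Plane)) (hu : LocallyIntegrable u)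
    (x : Plane) :
    partialC j (mollify volume φ u) x = ∫ t, (partialD j (φ.normed volume) t : ℂ) * u (x - t) := by
  have hφ : ContDiff ℝ 1 (φ.normed volume) := φ.contDiff_normed
  have hexists := (φ.hasCompactSupport_normed.fderiv ℝ).convolutionExists_left
    ((ContinuousLinearMap.lsmul ℝ ℝ : ℝ →L[ℝ] ℂ →L[ℝ] ℂ).precompL Plane)
    (hφ.continuous_fderiv one_ne_zero) hu x
  rw [partialC, mollify, (φ.hasCompactSupport_normed.hasFDerivAt_convolution_left
    (ContinuousLinearMap.lsmul ℝ ℝ) hφ hu x).fderiv, convolution,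
    ContinuousLinearMap.integral_apply hexists]
  simp only [ContinuousLinearMap.precompL_apply, ContinuousLinearMap.lsmul_apply,
    Complex.real_smul, partialD]

theorem partialD_comp_const_sub {f : Plane → ℝ} (hf : Differentiable ℝ f) (x y : Plane) :
    partialD j (fun y => f (x - y)) y = -partialD j f (x - y) := by
  have h := (hf (x - y)).hasFDerivAt.comp y ((hasFDerivAt_id y).const_sub x)
  rw [partialD, partialD, HasFDerivAt.fderiv (f := fun y => f (x - y)) h]
  simp only [ContinuousLinearMap.comp_apply, neg_apply,
    ContinuousLinearMap.id_apply, map_neg]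

theorem partialC_mollify (φ : ContDiffBump (0 : Plane)) (hu : LocallyIntegrable u)
    (hw : IsL2WeakPartial j u w) : partialC j (mollify volume φ u) = mollify volume φ w := by
  ext x
  have hφ : ContDiff ℝ ∞ (φ.normed volume) := φ.contDiff_normed
  have hreflect := hw.2 (fun y => φ.normed volume (x - y))
    (hφ.comp (contDiff_const.sub contDiff_id))
    (φ.hasCompactSupport_normed.comp_homeomorph (Homeomorph.subLeft x))
  simp only [partialD_comp_const_sub (hφ.differentiable (by simp)), Complex.ofReal_neg, neg_mul,
    integral_neg, neg_inj] at hreflect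
  calc partialC j (mollify volume φ u) x
      = ∫ t, (partialD j (φ.normed volume) t : ℂ) * u (x - t) :=
        partialC_mollify_eq_integral φ hu x
    _ = ∫ y, (partialD j (φ.normed volume) (x - y) : ℂ) * u y := by
        rw [← integral_sub_left_eq_self _ volume x]
        simp only [sub_sub_cancel]
    _ = ∫ y, (φ.normed volume (x - y) : ℂ) * w y := hreflect
    _ = ∫ t, (φ.normed volume t : ℂ) * w (x - t) := by
        rw [← integral_sub_left_eq_self _ volume x]
        simp only [sub_sub_cancel]
    _ = mollify volume φ w x := by
        simp only [mollify, convolution, ContinuousLinearMap.lsmul_apply, Complex.real_smul]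

end MollifiedDerivative

section Cutoff

/-- The profile of the cutoff functions. -/
def cutoffProfile : ContDiffBump (0 : Plane) := ⟨1, 2, one_pos, one_lt_two⟩

/-- Smooth cutoff functions, equal to one on the ball of radius `n + 1` and with gradients of size
`O(1 / n)`. -/
def cutoff (n : ℕ) (x : Plane) : ℝ := cutoffProfile ((1 / ((n : ℝ) + 1)) • x)

theorem contDiff_cutoff (n : ℕ) : ContDiff ℝ ∞ (cutoff n) :=
  cutoffProfile.contDiff.comp (contDiff_const_smul _)

theorem hasCompactSupport_cutoff (n : ℕ) : HasCompactSupport (cutoff n) :=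
  cutoffProfile.hasCompactSupport.comp_smul (by positivity)

theorem norm_cutoff_le_one (n : ℕ) (x : Plane) : ‖cutoff n x‖ ≤ 1 := by
  rw [cutoff, norm_of_nonneg cutoffProfile.nonneg]
  exact cutoffProfile.le_one

theorem tendsto_cutoff (x : Plane) : Tendsto (fun n => cutoff n x) atTop (𝓝 1) := by
  have hx : Tendsto (fun n : ℕ => (1 / ((n : ℝ) + 1)) • x) atTop (𝓝 0) := by
    simpa only [zero_smul] using (tendsto_one_div_add_atTop_nhds_zero_nat (𝕜 := ℝ)).smul_const x
  have h := (cutoffProfile.continuous.tendsto 0).comp hx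
  rwa [cutoffProfile.one_of_mem_closedBall
    (Metric.mem_closedBall_self cutoffProfile.rIn_pos.le)] at h

theorem exists_norm_partialD_cutoff_le (j : Fin 2) :
    ∃ C, ∀ n x, ‖partialD j (cutoff n) x‖ ≤ 1 / ((n : ℝ) + 1) * C := by
  have hχ : ContDiff ℝ 1 cutoffProfile := cutoffProfile.contDiff
  obtain ⟨C, hC⟩ := (cutoffProfile.hasCompactSupport.fderiv_apply ℝ
    (unitVec j)).exists_bound_of_continuous (continuous_partialD hχ j)
  refine ⟨C, fun n x => ?_⟩
  have hscale : partialD j (cutoff n) x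
      = 1 / ((n : ℝ) + 1) * partialD j cutoffProfile ((1 / ((n : ℝ) + 1)) • x) := by
    have h := (hχ.differentiable one_ne_zero ((1 / ((n : ℝ) + 1)) • x)).hasFDerivAt.comp x
      ((hasFDerivAt_id x).const_smul (1 / ((n : ℝ) + 1)))
    rw [partialD, partialD, HasFDerivAt.fderiv (f := cutoff n) h]
    simp only [ContinuousLinearMap.comp_apply, smul_apply,
      ContinuousLinearMap.id_apply, map_smul, smul_eq_mul]
  rw [hscale, norm_mul, norm_of_nonneg (by positivity)]
  gcongr
  exact hC _

theorem partialC_smul {χ : Plane → ℝ} {f : Plane → ℂ} (hχ : Differentiable ℝ χ)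
    (hf : Differentiable ℝ f) (j : Fin 2) :
    partialC j (fun x => χ x • f x)
      = (fun x => χ x • partialC j f x) + fun x => partialD j χ x • f x := by
  ext x
  rw [partialC, HasFDerivAt.fderiv (f := fun x => χ x • f x)
    ((hχ x).hasFDerivAt.smul (hf x).hasFDerivAt)]
  simp only [partialC, partialD, add_apply, smul_apply,
    ContinuousLinearMap.smulRight_apply, Pi.add_apply]

theorem tendstoL2_cutoff_smul {f : Plane → ℂ} (hf : MemLp f 2 volume) :
    TendstoL2 volume (fun n x => cutoff n x • f x) f := by
  simpa only [one_smul] using tendstoL2_smul_of_dominated hf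
    (fun n => (contDiff_cutoff n).continuous.aestronglyMeasurable)
    (aestronglyMeasurable_const (b := (1 : ℝ))) norm_cutoff_le_one tendsto_cutoff

theorem tendstoL2_partialD_cutoff_smul {f : Plane → ℂ} (hf : MemLp f 2 volume) (j : Fin 2) :
    TendstoL2 volume (fun n x => partialD j (cutoff n) x • f x) 0 := by
  obtain ⟨C, hC⟩ := exists_norm_partialD_cutoff_le j
  have hC0 : 0 ≤ C := by simpa using (norm_nonneg _).trans (hC 0 0)
  have hle : ∀ n x, ‖partialD j (cutoff n) x‖ ≤ C := fun n x =>
    (hC n x).trans (mul_le_of_le_one_left hC0 (by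
      rw [div_le_one (by positivity)]
      linarith [n.cast_nonneg (α := ℝ)]))
  have hlim : ∀ x, Tendsto (fun n => partialD j (cutoff n) x) atTop (𝓝 0) := fun x =>
    squeeze_zero_norm (fun n => hC n x) (by
      simpa only [zero_mul] using (tendsto_one_div_add_atTop_nhds_zero_nat (𝕜 := ℝ)).mul_const C)
  have hcont : ∀ n, Continuous (partialD j (cutoff n)) := fun n =>
    continuous_partialD ((contDiff_cutoff n).of_le (mod_cast le_top)) j
  have h := tendstoL2_smul_of_dominated hf (fun n => (hcont n).aestronglyMeasurable)
    (aestronglyMeasurable_const (b := (0 : ℝ))) hle hlim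
  simp only [zero_smul] at h
  exact h

end Cutoff

section Density

variable {u : Plane → ℂ} {w : Fin 2 → Plane → ℂ}

theorem tendsto_sobolevNorm_cutoff_smul {f : Plane → ℂ} (hf : ContDiff ℝ ∞ f)
    (hfL : MemLp f 2 volume) (hfd : ∀ j, MemLp (partialC j f) 2 volume) :
    Tendsto (fun n => sobolevNorm ((fun x => cutoff n x • f x) - f)
      ((fun j => partialC j fun x => cutoff n x • f x) - fun j => partialC j f)) atTop (𝓝 0) := by
  refine tendsto_sobolevNorm_zero (tendstoL2_cutoff_smul hfL).tendsto_eLpNorm fun j => ?_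
  have h := (tendstoL2_cutoff_smul (hfd j)).add (tendstoL2_partialD_cutoff_smul hfL j)
  simpa only [add_zero, Pi.sub_apply, partialC_smul ((contDiff_cutoff _).differentiable (by simp))
    (hf.differentiable (by simp))] using h.tendsto_eLpNorm

theorem exists_smooth_sobolevNorm_sub_lt (hu : MemLp u 2 volume)
    (hw : ∀ j, IsL2WeakPartial j u (w j)) {ε : ℝ≥0∞} (hε : 0 < ε) :
    ∃ f, ContDiff ℝ ∞ f ∧ MemLp f 2 volume ∧ (∀ j, MemLp (partialC j f) 2 volume) ∧
      sobolevNorm (f - u) ((fun j => partialC j f) - w) < ε := by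
  have huloc := hu.locallyIntegrable one_le_two
  let ψ : ℕ → ContDiffBump (0 : Plane) := fun n =>
    ⟨1 / ((n : ℝ) + 1) / 2, 1 / ((n : ℝ) + 1), by positivity, half_lt_self (by positivity)⟩
  have hψ : Tendsto (fun n => (ψ n).rOut) atTop (𝓝 0) := tendsto_one_div_add_atTop_nhds_zero_nat
  have hmem : ∀ {v : Plane → ℂ} (n : ℕ), MemLp v 2 volume →
      MemLp (mollify volume (ψ n) v) 2 volume := fun n hv =>
    ⟨(contDiff_mollify (hv.locallyIntegrable one_le_two)).continuous.aestronglyMeasurable,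
      (eLpNorm_mollify_le one_le_two ENNReal.ofNat_ne_top hv.1).trans_lt hv.2⟩
  have hlim : Tendsto (fun n => sobolevNorm (mollify volume (ψ n) u - u)
      ((fun j => mollify volume (ψ n) (w j)) - w)) atTop (𝓝 0) :=
    tendsto_sobolevNorm_zero
      (tendsto_eLpNorm_mollify_sub one_le_two ENNReal.ofNat_ne_top hψ hu) fun j =>
        tendsto_eLpNorm_mollify_sub one_le_two ENNReal.ofNat_ne_top hψ (hw j).1
  obtain ⟨n, hn⟩ := (hlim.eventually_lt_const hε).exists
  refine ⟨mollify volume (ψ n) u, contDiff_mollify huloc, hmem n hu, fun j => ?_, ?_⟩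
  · rw [partialC_mollify (ψ n) huloc (hw j)]
    exact hmem n (hw j).1
  · simpa only [partialC_mollify (ψ n) huloc (hw _)] using hn

theorem exists_testFunction_sobolevNorm_sub_lt (hu : MemLp u 2 volume)
    (hw : ∀ j, IsL2WeakPartial j u (w j)) {ε : ℝ≥0∞} (hε : 0 < ε) :
    ∃ φ, IsTestFunction φ ∧ sobolevNorm (φ - u) ((fun j => partialC j φ) - w) < ε := by
  obtain ⟨f, hf, hfL, hfd, hfu⟩ := exists_smooth_sobolevNorm_sub_lt hu hw hε
  obtain ⟨n, hn⟩ := ((tendsto_sobolevNorm_cutoff_smul hf hfL hfd).eventually_lt_const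
    (tsub_pos_of_lt hfu)).exists
  have hφ : IsTestFunction fun x => cutoff n x • f x :=
    ⟨(contDiff_cutoff n).smul hf, (hasCompactSupport_cutoff n).smul_right⟩
  refine ⟨_, hφ, ?_⟩
  rw [← sub_add_sub_cancel _ f u, ← sub_add_sub_cancel _ (fun j => partialC j f) w]
  calc _ ≤ _ := sobolevNorm_add_le (hφ.memLp.sub hfL).1 (hfL.sub hu).1
        (fun j => ((hφ.partialC j).memLp.sub (hfd j)).1) fun j => ((hfd j).sub (hw j).1).1
    _ < _ := ENNReal.add_lt_add_right hfu.ne_top hn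
    _ = ε := tsub_add_cancel_of_le hfu.le

theorem exists_testFunction_tendsto (hu : MemLp u 2 volume)
    (hw : ∀ j, IsL2WeakPartial j u (w j)) :
    ∃ φ : ℕ → Plane → ℂ, (∀ n, IsTestFunction (φ n)) ∧
      Tendsto (fun n => sobolevNorm (φ n - u) ((fun j => partialC j (φ n)) - w)) atTop (𝓝 0) := by
  choose φ hφ hlt using fun n : ℕ => exists_testFunction_sobolevNorm_sub_lt hu hw
    (ε := ((n : ℝ≥0∞) + 1)⁻¹) (ENNReal.inv_pos.2 (by simp))
  refine ⟨φ, hφ, tendsto_of_tendsto_of_tendsto_of_le_of_le tendsto_const_nhds ?_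
    (fun _ => zero_le) fun n => (hlt n).le⟩
  exact_mod_cast (tendsto_add_atTop_iff_nat 1).2 ENNReal.tendsto_inv_nat_nhds_zero

end Density

section IntegrationByParts

variable {φ ψ : Plane → ℂ}

theorem partialC_comm (hφ : ContDiff ℝ 2 φ) (i j : Fin 2) (x : Plane) :
    partialC i (partialC j φ) x = partialC j (partialC i φ) x := by
  have hd : DifferentiableAt ℝ (fderiv ℝ φ) x :=
    (hφ.fderiv_right (m := 1) le_rfl).differentiable one_ne_zero x
  have hsymm := hφ.contDiffAt.isSymmSndFDerivAt (x := x)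
    (minSmoothness_of_isRCLikeNormedField (𝕜 := ℝ)).le
  have happly : ∀ k l, partialC k (partialC l φ) x
      = fderiv ℝ (fderiv ℝ φ) x (unitVec k) (unitVec l) :=
    fun k l => by
      rw [partialC, HasFDerivAt.fderiv (f := partialC l φ)
        (hd.hasFDerivAt.clm_apply (hasFDerivAt_const (unitVec l) x))]
      simp
  rw [happly, happly, hsymm.eq]

theorem IsTestFunction.integrable_inner (hφ : IsTestFunction φ) (hψ : IsTestFunction ψ) :
    Integrable fun x => inner ℝ (φ x) (ψ x) :=
  (hφ.continuous.inner hψ.continuous).integrable_of_hasCompactSupport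
    (hφ.hasCompactSupport.mono fun x hx h0 => hx (by simp only [h0, inner_zero_left]))

theorem IsTestFunction.I_mul (hφ : IsTestFunction φ) :
    IsTestFunction fun x => Complex.I * φ x :=
  ⟨contDiff_const.mul hφ.contDiff, hφ.hasCompactSupport.mul_left⟩

theorem integral_inner_partialC_partialC (hφ : IsTestFunction φ) (hψ : IsTestFunction ψ)
    (i j : Fin 2) :
    ∫ x, inner ℝ (φ x) (partialC i (partialC j ψ) x)
      = -∫ x, inner ℝ (partialC i φ x) (partialC j ψ x) :=
  integral_bilinear_fderiv_right_eq_neg_left_of_integrable (B := innerSL ℝ (E := ℂ))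
    ((hφ.partialC i).integrable_inner (hψ.partialC j))
    (hφ.integrable_inner ((hψ.partialC j).partialC i)) (hφ.integrable_inner (hψ.partialC j))
    (fun x _ => hφ.differentiable x) (fun x _ => (hψ.partialC j).differentiable x)

theorem integral_inner_partialC_comm (hφ : IsTestFunction φ) (hψ : IsTestFunction ψ) (i j : Fin 2) :
    ∫ x, inner ℝ (partialC i φ x) (partialC j ψ x)
      = ∫ x, inner ℝ (partialC j φ x) (partialC i ψ x) := by
  have hcomm := partialC_comm
    (hψ.contDiff.of_le (WithTop.coe_le_coe.2 (le_top (a := (2 : ℕ∞))))) i j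
  rw [← neg_inj, ← integral_inner_partialC_partialC hφ hψ, ← integral_inner_partialC_partialC hφ hψ]
  simp only [hcomm]

theorem integral_inner_partialC_I_mul (hφ : IsTestFunction φ) :
    ∫ x, inner ℝ (partialC 0 φ x) (Complex.I * partialC 1 φ x) = 0 := by
  have hpartial : ∀ j x, partialC j (fun x => Complex.I * φ x) x = Complex.I * partialC j φ x :=
    fun j x => by
      rw [partialC, fderiv_const_mul (hφ.differentiable x), smul_apply, smul_eq_mul]
      rfl
  have hcomm := integral_inner_partialC_comm hφ hφ.I_mul 0 1
  simp only [hpartial] at hcomm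
  have hskew : ∀ a b : ℂ, inner ℝ a (Complex.I * b) = -inner ℝ b (Complex.I * a) := fun a b => by
    simp only [Complex.inner, Complex.mul_re, Complex.mul_im, Complex.conj_re, Complex.conj_im,
      Complex.I_re, Complex.I_im]
    ring
  simp only [hskew (partialC 1 φ _), integral_neg] at hcomm
  linarith

end IntegrationByParts

namespace IsTestFunction

variable {φ : Plane → ℂ}

theorem contDiff_norm_sq (hφ : IsTestFunction φ) : ContDiff ℝ 1 fun x => ‖φ x‖ ^ 2 :=
  hφ.contDiff_one.norm_sq ℝ

theorem hasCompactSupport_norm_sq (hφ : IsTestFunction φ) :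
    HasCompactSupport fun x => ‖φ x‖ ^ 2 :=
  hφ.hasCompactSupport.comp_left (g := fun z : ℂ => ‖z‖ ^ 2) (by simp)

theorem partialD_norm_sq (hφ : IsTestFunction φ) (j : Fin 2) (x : Plane) :
    partialD j (fun x => ‖φ x‖ ^ 2) x = 2 * inner ℝ (φ x) (PauliHardy.partialC j φ x) := by
  rw [partialD, ((hφ.differentiable x).hasFDerivAt.norm_sq).fderiv]
  simp only [smul_apply, ContinuousLinearMap.comp_apply, coe_innerSL_apply, Complex.inner,
    Complex.mul_re, Complex.conj_re, Complex.conj_im, mul_neg, sub_neg_eq_add, smul_add,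
    nsmul_eq_mul, Nat.cast_ofNat, PauliHardy.partialC]
  ring

end IsTestFunction

section QuadraticForm

variable {B : Plane → ℝ} {δ M : ℝ} {φ : Plane → ℂ}

/-- The component `i ∂_j φ + A_j φ` of the magnetic gradient of a smooth function. -/
def magneticDeriv (B : Plane → ℝ) (j : Fin 2) (φ : Plane → ℂ) (x : Plane) : ℂ :=
  Complex.I * partialC j φ x + (vectorPot B x j : ℂ) * φ x

/-- The combination `D₀ + i D₁` of the magnetic derivatives, through which the spin-down Pauli
operator factorizes. -/
def spinDeriv (B : Plane → ℝ) (φ : Plane → ℂ) (x : Plane) : ℂ :=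
  magneticDeriv B 0 φ x + Complex.I * magneticDeriv B 1 φ x

theorem norm_sq_spinDeriv (hφ : IsTestFunction φ) (x : Plane) :
    ‖spinDeriv B φ x‖ ^ 2 = ∑ j, ‖magneticDeriv B j φ x‖ ^ 2
      + 2 * inner ℝ (partialC 0 φ x) (Complex.I * partialC 1 φ x)
      - ∑ j, partialD j (scalarPot B) x * partialD j (fun x => ‖φ x‖ ^ 2) x := by
  rw [Fin.sum_univ_two, Fin.sum_univ_two, hφ.partialD_norm_sq, hφ.partialD_norm_sq]
  simp only [spinDeriv, magneticDeriv, vectorPot, Complex.inner,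
    ← Complex.normSq_eq_norm_sq, Complex.normSq_apply, Matrix.cons_val_zero,
    Matrix.cons_val_one, Complex.mul_re, Complex.mul_im, Complex.conj_re,
    Complex.conj_im, Complex.add_re, Complex.add_im, Complex.ofReal_re, Complex.ofReal_im,
    Complex.I_re, Complex.I_im]
  ring

namespace PotentialBounds

theorem continuous_vectorPot (h : PotentialBounds B δ M) (j : Fin 2) :
    Continuous fun x => vectorPot B x j := by
  fin_cases j
  · exact continuous_partialD h.contDiff_scalarPot 1
  · exact (continuous_partialD h.contDiff_scalarPot 0).neg

theorem exists_abs_vectorPot_le (h : PotentialBounds B δ M) :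
    ∃ A, ∀ j x, |vectorPot B x j| ≤ A := by
  obtain ⟨A, -, hA⟩ := h.exists_abs_partialD_le
  refine ⟨A, fun j x => ?_⟩
  fin_cases j
  · exact hA 1 x
  · exact (abs_neg _).trans_le (hA 0 x)

theorem memLp_magneticDeriv (h : PotentialBounds B δ M) (hφ : IsTestFunction φ) (j : Fin 2) :
    MemLp (magneticDeriv B j φ) 2 volume :=
  Continuous.memLp_of_hasCompactSupport
    ((continuous_const.mul (hφ.partialC j).continuous).add
      ((Complex.continuous_ofReal.comp (h.continuous_vectorPot j)).mul hφ.continuous))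
    ((hφ.partialC j).hasCompactSupport.mul_left.add hφ.hasCompactSupport.mul_left)

theorem integrable_mul_norm_sq (h : PotentialBounds B δ M) (hφ : IsTestFunction φ) :
    Integrable fun x => B x * ‖φ x‖ ^ 2 := by
  have hcont := hφ.contDiff_norm_sq.continuous
  obtain ⟨C, hC⟩ := hφ.hasCompactSupport_norm_sq.exists_bound_of_continuous hcont
  exact h.int.mul_bdd hcont.aestronglyMeasurable (Eventually.of_forall hC)

theorem integral_norm_sq_spinDeriv (h : PotentialBounds B δ M) (hφ : IsTestFunction φ) :
    ∫ x, ‖spinDeriv B φ x‖ ^ 2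
      = (∑ j, ∫ x, ‖magneticDeriv B j φ x‖ ^ 2) - ∫ x, B x * ‖φ x‖ ^ 2 := by
  have hmag : ∀ j ∈ Finset.univ, Integrable fun x => ‖magneticDeriv B j φ x‖ ^ 2 := fun j _ =>
    have hj := h.memLp_magneticDeriv hφ j
    (memLp_two_iff_integrable_sq_norm hj.1).1 hj
  have hcross : Integrable fun x =>
      2 * inner ℝ (partialC 0 φ x) (Complex.I * partialC 1 φ x) :=
    ((hφ.partialC 0).integrable_inner (hφ.partialC 1).I_mul).const_mul 2
  have hgrad : Integrable fun x =>
      ∑ j, partialD j (scalarPot B) x * partialD j (fun x => ‖φ x‖ ^ 2) x :=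
    integrable_finsetSum _ fun j _ => Continuous.integrable_of_hasCompactSupport
      ((continuous_partialD h.contDiff_scalarPot j).mul (continuous_partialD hφ.contDiff_norm_sq j))
      (hφ.hasCompactSupport_norm_sq.fderiv_apply ℝ _).mul_left
  have hsum := integrable_finsetSum _ hmag
  simp only [norm_sq_spinDeriv hφ]
  rw [integral_sub (f := fun x => (∑ j, ‖magneticDeriv B j φ x‖ ^ 2)
      + 2 * inner ℝ (partialC 0 φ x) (Complex.I * partialC 1 φ x)) (hsum.add hcross) hgrad,
    integral_add hsum hcross, integral_finsetSum _ hmag,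
    integral_const_mul, integral_inner_partialC_I_mul hφ, mul_zero, add_zero,
    h.integral_partialD_mul hφ.contDiff_norm_sq hφ.hasCompactSupport_norm_sq]

end PotentialBounds

end QuadraticForm

section FormBound

variable {B : Plane → ℝ} {δ M : ℝ} {φ : Plane → ℂ}

theorem norm_sqrt_abs_smul_sq (b : ℝ) (z : ℂ) : ‖√|b| • z‖ ^ 2 = |b| * ‖z‖ ^ 2 := by
  rw [norm_smul, mul_pow, norm_of_nonneg (sqrt_nonneg _), sq_sqrt (abs_nonneg b)]

namespace PotentialBounds

theorem abs (h : PotentialBounds B δ M) : PotentialBounds (fun y => |B y|) δ M where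
  pos := h.pos
  le_one := h.le_one
  int := h.int.abs
  moment := by simpa only [abs_abs] using h.moment
  kernel := by simpa only [abs_abs] using h.kernel
  kernel_le := by simpa only [abs_abs] using h.kernel_le

-- The weak Poisson equation for the potential of `|B|` turns `∫ |B| |φ|²` into an integral
-- of `∇|φ|²` against a bounded field.
theorem exists_integral_abs_mul_le (h : PotentialBounds B δ M) :
    ∃ A, 0 ≤ A ∧ ∀ φ : Plane → ℂ, IsTestFunction φ → ∫ x, |B x| * ‖φ x‖ ^ 2
      ≤ A * (2 * (∫ x, ‖φ x‖ ^ 2) + ∑ j, ∫ x, ‖partialC j φ x‖ ^ 2) := by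
  obtain ⟨A, hA0, hA⟩ := h.abs.exists_abs_partialD_le
  refine ⟨A, hA0, fun φ hφ => ?_⟩
  have hpt : ∀ j x, ‖partialD j (scalarPot fun y => |B y|) x
      * partialD j (fun x => ‖φ x‖ ^ 2) x‖ ≤ A * (‖φ x‖ ^ 2 + ‖partialC j φ x‖ ^ 2) :=
    fun j x => by
      rw [norm_mul, hφ.partialD_norm_sq, norm_mul, norm_two]
      gcongr
      · exact hA j x
      · linarith [norm_inner_le_norm (𝕜 := ℝ) (φ x) (partialC j φ x),
          two_mul_le_add_sq ‖φ x‖ ‖partialC j φ x‖]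
  have hint : ∀ j ∈ Finset.univ, Integrable fun x => A * (‖φ x‖ ^ 2 + ‖partialC j φ x‖ ^ 2) :=
    fun j _ => (hφ.integrable_norm_sq.add (hφ.partialC j).integrable_norm_sq).const_mul A
  calc ∫ x, |B x| * ‖φ x‖ ^ 2
      = ∫ x, ∑ j, partialD j (scalarPot fun y => |B y|) x * partialD j (fun x => ‖φ x‖ ^ 2) x :=
        (h.abs.integral_partialD_mul hφ.contDiff_norm_sq hφ.hasCompactSupport_norm_sq).symm
    _ ≤ ∫ x, ∑ j, A * (‖φ x‖ ^ 2 + ‖partialC j φ x‖ ^ 2) :=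
        (le_norm_self _).trans (norm_integral_le_of_norm_le (integrable_finsetSum _ hint)
          (Eventually.of_forall fun x => norm_sum_le_of_le _ fun j _ => hpt j x))
    _ = ∑ j, A * ((∫ x, ‖φ x‖ ^ 2) + ∫ x, ‖partialC j φ x‖ ^ 2) := by
        rw [integral_finsetSum _ hint]
        simp only [integral_const_mul,
          integral_add hφ.integrable_norm_sq (hφ.partialC _).integrable_norm_sq]
    _ = A * (2 * (∫ x, ‖φ x‖ ^ 2) + ∑ j, ∫ x, ‖partialC j φ x‖ ^ 2) := by
        simp only [Fin.sum_univ_two]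
        ring

theorem memLp_sqrt_abs_smul (h : PotentialBounds B δ M) (hφ : IsTestFunction φ) :
    MemLp (fun x => √|B x| • φ x) 2 volume := by
  refine (memLp_two_iff_integrable_sq_norm (f := fun x => √|B x| • φ x)
    (h.int.1.norm.aemeasurable.sqrt.aestronglyMeasurable.smul
      hφ.continuous.aestronglyMeasurable)).2 ?_
  simpa only [norm_sqrt_abs_smul_sq] using h.abs.integrable_mul_norm_sq hφ

theorem exists_eLpNorm_sqrt_abs_smul_le (h : PotentialBounds B δ M) :
    ∃ C : ℝ, ∀ φ : Plane → ℂ, IsTestFunction φ →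
      eLpNorm (fun x => √|B x| • φ x) 2 volume
        ≤ ENNReal.ofReal C * sobolevNorm φ fun j => partialC j φ := by
  obtain ⟨A, hA0, hA⟩ := h.exists_integral_abs_mul_le
  refine ⟨√(2 * A), fun φ hφ => ?_⟩
  rw [sobolevNorm, Fin.sum_univ_two, eLpNorm_two_eq_ofReal_sqrt (h.memLp_sqrt_abs_smul hφ),
    eLpNorm_two_eq_ofReal_sqrt hφ.memLp, eLpNorm_two_eq_ofReal_sqrt (hφ.partialC 0).memLp,
    eLpNorm_two_eq_ofReal_sqrt (hφ.partialC 1).memLp,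
    ← ENNReal.ofReal_add (by positivity) (by positivity),
    ← ENNReal.ofReal_add (by positivity) (by positivity), ← ENNReal.ofReal_mul (by positivity)]
  refine ENNReal.ofReal_le_ofReal (sqrt_le_iff.2 ⟨by positivity, ?_⟩)
  simp only [norm_sqrt_abs_smul_sq]
  refine (hA φ hφ).trans ?_
  rw [Fin.sum_univ_two, mul_pow, sq_sqrt (by positivity), mul_comm 2 A, mul_assoc]
  have hsq : ∀ f : Plane → ℂ, √(∫ x, ‖f x‖ ^ 2) ^ 2 = ∫ x, ‖f x‖ ^ 2 := fun f =>
    sq_sqrt (integral_nonneg fun x => sq_nonneg _)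
  have hφsq := hsq φ
  have h0sq := hsq (partialC 0 φ)
  have h1sq := hsq (partialC 1 φ)
  have ha := sqrt_nonneg (∫ x, ‖φ x‖ ^ 2)
  have hb := sqrt_nonneg (∫ x, ‖partialC 0 φ x‖ ^ 2)
  have hc := sqrt_nonneg (∫ x, ‖partialC 1 φ x‖ ^ 2)
  gcongr
  nlinarith [mul_nonneg ha hb, mul_nonneg ha hc, mul_nonneg hb hc]

end PotentialBounds

end FormBound

section HardyWeight

variable {α ρ C : ℝ} {w : ℝ → ℝ}

/-- `w` is a bounded radial weight for which the Cauchy–Riemann operator satisfies a Hardy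
inequality with constant `C` in the measure `g₋(ρ; |x|)² dx`. -/
structure IsHardyWeight (α ρ C : ℝ) (w : ℝ → ℝ) : Prop where
  const_nonneg : 0 ≤ C
  continuous : Continuous w
  nonneg : ∀ r, 0 ≤ w r
  bounded : ∃ A, ∀ r, w r ≤ A
  integral_le : ∀ v : Plane → ℂ, ContDiff ℝ 1 v → HasCompactSupport v →
    C * ∫ x : Plane, gMinus α ρ ‖x‖ ^ 2 * w ‖x‖ * ‖v x‖ ^ 2
      ≤ ∫ x : Plane, gMinus α ρ ‖x‖ ^ 2 * ‖cauchyRiemann v x‖ ^ 2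

theorem isHardyWeight_inv_sq (hα : α ≤ 0) (hρ : 0 < ρ) :
    IsHardyWeight α ρ (distInt α ^ 2) fun r => (ρ ^ 2 + r ^ 2)⁻¹ where
  const_nonneg := sq_nonneg _
  continuous := .inv₀ (by fun_prop) fun r => by positivity
  nonneg r := by positivity
  bounded := ⟨(ρ ^ 2)⁻¹, fun r => by
    gcongr
    exact le_add_of_nonneg_right (sq_nonneg r)⟩
  integral_le v hv hvc := by
    simpa only [mul_left_comm _ (distInt α ^ 2), mul_assoc, integral_const_mul] using
      (isHardyDrift_distInt hα hρ).integral_le hρ hv hvc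

theorem isHardyWeight_logWeight (hα : α ≤ 0) (hint : ∃ n : ℤ, (n : ℝ) = α) (hρ : 0 < ρ) :
    IsHardyWeight α ρ (|α| / (4 * |α| + π)) (logWeight ρ) where
  const_nonneg := by positivity
  continuous := continuous_logWeight hρ
  nonneg := logWeight_nonneg ρ
  bounded := ⟨(ρ ^ 2)⁻¹, logWeight_le_inner hρ⟩
  integral_le v hv hvc := by
    obtain ⟨lam, Q, Q', h⟩ := exists_isHardyDrift_logWeight hα hint hρ
    simpa only [mul_left_comm _ (|α| / (4 * |α| + π)), mul_assoc, integral_const_mul] using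
      h.integral_le hρ hv hvc

theorem IsHardyWeight.integrable_mul_norm_sq (hw : IsHardyWeight α ρ C w) {u : Plane → ℂ}
    (hu : MemLp u 2 volume) : Integrable fun x => w ‖x‖ * ‖u x‖ ^ 2 := by
  obtain ⟨A, hA⟩ := hw.bounded
  refine ((memLp_two_iff_integrable_sq_norm hu.1).1 hu).bdd_mul
    (hw.continuous.comp continuous_norm).aestronglyMeasurable (c := A)
    (Eventually.of_forall fun x => ?_)
  rw [norm_of_nonneg (hw.nonneg _)]
  exact hA _

end HardyWeight

section Gauge

variable {B : Plane → ℝ} {δ M ρ C : ℝ} {φ : Plane → ℂ} {w : ℝ → ℝ}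

/-- The gauge-transformed function `e^{-h} φ`, which turns the spin-down factor `spinDeriv` into
the Cauchy–Riemann operator. -/
def gauge (B : Plane → ℝ) (φ : Plane → ℂ) (x : Plane) : ℂ := exp (-scalarPot B x) • φ x

theorem hasCompactSupport_gauge (hc : HasCompactSupport φ) : HasCompactSupport (gauge B φ) :=
  hc.mono fun x hx h0 => hx (by simp only [gauge, h0, smul_zero])

theorem norm_eq_exp_mul_norm_gauge (φ : Plane → ℂ) (x : Plane) :
    ‖φ x‖ = exp (scalarPot B x) * ‖gauge B φ x‖ := by
  rw [gauge, norm_smul, norm_of_nonneg (exp_nonneg _), ← mul_assoc, ← exp_add, add_neg_cancel,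
    exp_zero, one_mul]

namespace PotentialBounds

theorem contDiff_gauge (h : PotentialBounds B δ M) (hφ : IsTestFunction φ) :
    ContDiff ℝ 1 (gauge B φ) :=
  h.contDiff_scalarPot.neg.exp.smul hφ.contDiff_one

theorem partialC_gauge (h : PotentialBounds B δ M) (hφ : IsTestFunction φ) (j : Fin 2)
    (x : Plane) : partialC j (gauge B φ) x
      = exp (-scalarPot B x) • (partialC j φ x - (partialD j (scalarPot B) x : ℂ) * φ x) := by
  have hdiff := h.contDiff_scalarPot.differentiable one_ne_zero
  have hneg : ∀ y, HasFDerivAt (fun x => exp (-scalarPot B x))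
      (exp (-scalarPot B y) • -fderiv ℝ (scalarPot B) y) y := fun y =>
    (hdiff y).hasFDerivAt.fun_neg.exp
  have hexp : partialD j (fun x => exp (-scalarPot B x)) x
      = -(exp (-scalarPot B x) * partialD j (scalarPot B) x) := by
    rw [partialD, (hneg x).fderiv, smul_apply, neg_apply, smul_eq_mul,
      mul_neg, partialD]
  unfold gauge
  rw [partialC_smul (fun y => (hneg y).differentiableAt) hφ.differentiable, Pi.add_apply, hexp,
    neg_smul, mul_smul, ← sub_eq_add_neg, ← smul_sub, Complex.real_smul (x := partialD j _ x)]

theorem cauchyRiemann_gauge (h : PotentialBounds B δ M) (hφ : IsTestFunction φ) (x : Plane) :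
    cauchyRiemann (gauge B φ) x = exp (-scalarPot B x) • (-Complex.I * spinDeriv B φ x) := by
  rw [cauchyRiemann, h.partialC_gauge hφ, h.partialC_gauge hφ]
  simp only [spinDeriv, magneticDeriv, vectorPot, Matrix.cons_val_zero, Matrix.cons_val_one,
    Complex.real_smul]
  push_cast
  linear_combination Complex.exp (-(scalarPot B x : ℂ)) * (partialC 0 φ x
    + Complex.I * partialC 1 φ x - (partialD 0 (scalarPot B) x : ℂ) * φ x) * Complex.I_sq

theorem norm_spinDeriv (h : PotentialBounds B δ M) (hφ : IsTestFunction φ) (x : Plane) :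
    ‖spinDeriv B φ x‖ = exp (scalarPot B x) * ‖cauchyRiemann (gauge B φ) x‖ := by
  rw [h.cauchyRiemann_gauge hφ, norm_smul, norm_of_nonneg (exp_nonneg _), ← mul_assoc, ← exp_add,
    add_neg_cancel, exp_zero, one_mul, norm_mul, norm_neg, Complex.norm_I, one_mul]

end PotentialBounds

theorem kMinus_nonneg (hρ : 0 < ρ) : 0 ≤ kMinus B ρ :=
  le_ciInf fun _ => div_nonneg (exp_nonneg _) (gMinus_pos hρ).le

theorem kMinus_mul_le (hρ : 0 < ρ) (x : Plane) :
    kMinus B ρ * gMinus (flux B) ρ ‖x‖ ≤ exp (scalarPot B x) := by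
  rw [← le_div_iff₀ (gMinus_pos hρ)]
  refine ciInf_le ⟨0, ?_⟩ x
  rintro _ ⟨y, rfl⟩
  exact div_nonneg (exp_nonneg _) (gMinus_pos hρ).le

theorem exp_scalarPot_le (hρ : 0 < ρ)
    (hK : BddAbove (range fun x : Plane => exp (scalarPot B x) / gMinus (flux B) ρ ‖x‖))
    (x : Plane) : exp (scalarPot B x) ≤ capKMinus B ρ * gMinus (flux B) ρ ‖x‖ := by
  rw [← div_le_iff₀ (gMinus_pos hρ)]
  exact le_ciSup hK x

namespace PotentialBounds

theorem kMinus_sq_mul_integral_le (h : PotentialBounds B δ M) (hρ : 0 < ρ)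
    (hφ : IsTestFunction φ) :
    kMinus B ρ ^ 2 * ∫ x, gMinus (flux B) ρ ‖x‖ ^ 2 * ‖cauchyRiemann (gauge B φ) x‖ ^ 2
      ≤ ∫ x, ‖spinDeriv B φ x‖ ^ 2 := by
  have hspin : MemLp (spinDeriv B φ) 2 volume :=
    (h.memLp_magneticDeriv hφ 0).add ((h.memLp_magneticDeriv hφ 1).const_mul Complex.I)
  rw [← integral_const_mul]
  refine integral_mono_of_nonneg (Eventually.of_forall fun x => by positivity)
    ((memLp_two_iff_integrable_sq_norm hspin.1).1 hspin) (Eventually.of_forall fun x => ?_)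
  calc kMinus B ρ ^ 2 * (gMinus (flux B) ρ ‖x‖ ^ 2 * ‖cauchyRiemann (gauge B φ) x‖ ^ 2)
      = (kMinus B ρ * gMinus (flux B) ρ ‖x‖ * ‖cauchyRiemann (gauge B φ) x‖) ^ 2 := by ring
    _ ≤ (exp (scalarPot B x) * ‖cauchyRiemann (gauge B φ) x‖) ^ 2 := by
        have hk := mul_nonneg (kMinus_nonneg (B := B) hρ)
          (gMinus_pos (α := flux B) (r := ‖x‖) hρ).le
        gcongr
        exact kMinus_mul_le hρ x
    _ = ‖spinDeriv B φ x‖ ^ 2 := by rw [h.norm_spinDeriv hφ]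

theorem integral_mul_norm_sq_le (h : PotentialBounds B δ M) (hρ : 0 < ρ)
    (hw : Continuous w) (hw₀ : ∀ r, 0 ≤ w r)
    (hK : BddAbove (range fun x : Plane => exp (scalarPot B x) / gMinus (flux B) ρ ‖x‖))
    (hφ : IsTestFunction φ) :
    ∫ x, w ‖x‖ * ‖φ x‖ ^ 2
      ≤ capKMinus B ρ ^ 2 * ∫ x, gMinus (flux B) ρ ‖x‖ ^ 2 * w ‖x‖ * ‖gauge B φ x‖ ^ 2 := by
  have hcont : Continuous fun x : Plane => gMinus (flux B) ρ ‖x‖ ^ 2 * w ‖x‖ :=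
    ((continuous_gMinus_sq hρ).mul hw).comp continuous_norm
  have hsupp : HasCompactSupport fun x => ‖gauge B φ x‖ ^ 2 :=
    (hasCompactSupport_gauge hφ.hasCompactSupport).comp_left (g := fun z : ℂ => ‖z‖ ^ 2)
      (by simp only [norm_zero, zero_pow two_ne_zero])
  have hint := (hcont.mul ((h.contDiff_gauge hφ).continuous.norm.pow 2)
    |>.integrable_of_hasCompactSupport (μ := volume) hsupp.mul_left)
  rw [← integral_const_mul]
  refine integral_mono_of_nonneg (Eventually.of_forall fun x => mul_nonneg (hw₀ _) (sq_nonneg _))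
    (hint.const_mul _) (Eventually.of_forall fun x => ?_)
  have hw₀x := hw₀ ‖x‖
  calc w ‖x‖ * ‖φ x‖ ^ 2
      = w ‖x‖ * (exp (scalarPot B x) * ‖gauge B φ x‖) ^ 2 := by
        rw [← norm_eq_exp_mul_norm_gauge]
    _ ≤ w ‖x‖ * (capKMinus B ρ * gMinus (flux B) ρ ‖x‖ * ‖gauge B φ x‖) ^ 2 := by
        gcongr
        exact exp_scalarPot_le hρ hK x
    _ = capKMinus B ρ ^ 2 * (gMinus (flux B) ρ ‖x‖ ^ 2 * w ‖x‖ * ‖gauge B φ x‖ ^ 2) := by ring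

theorem hardy_testFunction (h : PotentialBounds B δ M) (hρ : 0 < ρ)
    (hw : IsHardyWeight (flux B) ρ C w) (hφ : IsTestFunction φ) :
    betaMinus B ρ * C * ∫ x, w ‖x‖ * ‖φ x‖ ^ 2 ≤ ∫ x, ‖spinDeriv B φ x‖ ^ 2 := by
  by_cases hK : BddAbove (range fun x : Plane => exp (scalarPot B x) / gMinus (flux B) ρ ‖x‖)
  swap
  · -- Here the supremum `K₋` takes the junk value `0`, and so does `β₋`.
    have hK₀ : capKMinus B ρ = 0 := iSup_of_not_bddAbove hK
    rw [betaMinus, hK₀, div_zero, zero_pow two_ne_zero, zero_mul, zero_mul]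
    exact integral_nonneg fun x => sq_nonneg _
  have hKpos : 0 < capKMinus B ρ :=
    pos_of_mul_pos_left ((exp_pos _).trans_le (exp_scalarPot_le hρ hK 0)) (gMinus_pos hρ).le
  have hC := hw.const_nonneg
  calc betaMinus B ρ * C * ∫ x, w ‖x‖ * ‖φ x‖ ^ 2
      ≤ betaMinus B ρ * C * (capKMinus B ρ ^ 2
          * ∫ x, gMinus (flux B) ρ ‖x‖ ^ 2 * w ‖x‖ * ‖gauge B φ x‖ ^ 2) := by
        have hβ : 0 ≤ betaMinus B ρ := sq_nonneg _
        gcongr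
        exact h.integral_mul_norm_sq_le hρ hw.continuous hw.nonneg hK hφ
    _ = kMinus B ρ ^ 2
          * (C * ∫ x, gMinus (flux B) ρ ‖x‖ ^ 2 * w ‖x‖ * ‖gauge B φ x‖ ^ 2) := by
        rw [betaMinus]
        field_simp
    _ ≤ kMinus B ρ ^ 2
          * ∫ x, gMinus (flux B) ρ ‖x‖ ^ 2 * ‖cauchyRiemann (gauge B φ) x‖ ^ 2 := by
        gcongr
        exact hw.integral_le _ (h.contDiff_gauge hφ)
          (hasCompactSupport_gauge hφ.hasCompactSupport)
    _ ≤ ∫ x, ‖spinDeriv B φ x‖ ^ 2 := h.kMinus_sq_mul_integral_le hρ hφ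

end PotentialBounds

end Gauge

section FormDomain

variable {B : Plane → ℝ} {δ M ρ C : ℝ} {u : Plane → ℂ} {w : ℝ → ℝ}

theorem isL2WeakPartial_weakPartial (hu : MemH1 u) (j : Fin 2) :
    IsL2WeakPartial j u (weakPartial j u) := by
  rw [weakPartial, dif_pos (hu.2 j)]
  exact (hu.2 j).choose_spec

/-- The `H¹` distance between a smooth function, taken with its classical derivatives, and an
element of `H¹`, taken with its weak derivatives. -/
def sobolevDist (φ u : Plane → ℂ) : ℝ≥0∞ :=
  sobolevNorm (φ - u) fun j => partialC j φ - weakPartial j u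

/-- Convergence `φ n → u` in `H¹(ℝ²)` of a sequence of test functions. -/
structure TendstoH1 (φ : ℕ → Plane → ℂ) (u : Plane → ℂ) : Prop where
  isTestFunction : ∀ n, IsTestFunction (φ n)
  memH1 : MemH1 u
  tendsto_sobolevDist : Tendsto (fun n => sobolevDist (φ n) u) atTop (𝓝 0)

theorem exists_tendstoH1 (hu : MemH1 u) : ∃ φ, TendstoH1 φ u := by
  obtain ⟨φ, hφ, hlim⟩ := exists_testFunction_tendsto hu.1 (isL2WeakPartial_weakPartial hu)
  exact ⟨φ, hφ, hu, hlim⟩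

namespace TendstoH1

variable {φ : ℕ → Plane → ℂ}

theorem tendstoL2 (hφ : TendstoH1 φ u) : TendstoL2 volume φ u where
  memLp n := (hφ.isTestFunction n).memLp
  memLp_limit := hφ.memH1.1
  tendsto_eLpNorm := tendsto_of_tendsto_of_tendsto_of_le_of_le tendsto_const_nhds
    hφ.tendsto_sobolevDist (fun _ => zero_le) fun _ => le_self_add

theorem tendstoL2_partialC (hφ : TendstoH1 φ u) (j : Fin 2) :
    TendstoL2 volume (fun n => partialC j (φ n)) (weakPartial j u) where
  memLp n := ((hφ.isTestFunction n).partialC j).memLp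
  memLp_limit := (isL2WeakPartial_weakPartial hφ.memH1 j).1
  tendsto_eLpNorm := tendsto_of_tendsto_of_tendsto_of_le_of_le tendsto_const_nhds
    hφ.tendsto_sobolevDist (fun _ => zero_le) fun n =>
      (Finset.single_le_sum (f := fun j => eLpNorm (partialC j (φ n) - weakPartial j u) 2 volume)
        (fun _ _ => zero_le) (Finset.mem_univ j)).trans le_add_self

theorem sobolevNorm_sub_le (hφ : TendstoH1 φ u) (n m : ℕ) :
    sobolevNorm (φ n - φ m) (fun j => partialC j (φ n - φ m))
      ≤ sobolevDist (φ n) u + sobolevDist (φ m) u := by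
  have hmeas := fun n => (((hφ.isTestFunction n).memLp (p := 2)).sub hφ.memH1.1).1
  have hmeas' := fun n j => ((((hφ.isTestFunction n).partialC j).memLp (p := 2)).sub
    (isL2WeakPartial_weakPartial hφ.memH1 j).1).1
  calc sobolevNorm (φ n - φ m) (fun j => partialC j (φ n - φ m))
      = sobolevNorm ((φ n - u) + -(φ m - u)) ((fun j => partialC j (φ n) - weakPartial j u)
          + -fun j => partialC j (φ m) - weakPartial j u) := by
        congr 1
        · abel
        · funext j
          rw [(hφ.isTestFunction n).partialC_sub (hφ.isTestFunction m), Pi.add_apply, Pi.neg_apply]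
          abel
    _ ≤ _ := sobolevNorm_add_le (hmeas n) (hmeas m).neg (hmeas' n) fun j => (hmeas' m j).neg
    _ = _ := by rw [sobolevNorm_neg, sobolevDist, sobolevDist]

theorem sqrt_abs_smul (hφ : TendstoH1 φ u) (h : PotentialBounds B δ M) :
    TendstoL2 volume (fun n x => √|B x| • φ n x) fun x => √|B x| • u x := by
  obtain ⟨C, hC⟩ := h.exists_eLpNorm_sqrt_abs_smul_le
  refine hφ.tendstoL2.smul_of_cauchy h.int.1.norm.aemeasurable.sqrt.aestronglyMeasurable
    (fun n => h.memLp_sqrt_abs_smul (hφ.isTestFunction n))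
    (b := fun n => ENNReal.ofReal C * sobolevDist (φ n) u)
    (by simpa only [mul_zero] using
      ENNReal.Tendsto.const_mul hφ.tendsto_sobolevDist (.inr ENNReal.ofReal_ne_top)) fun n m => ?_
  rw [← mul_add]
  exact (hC _ ((hφ.isTestFunction n).sub (hφ.isTestFunction m))).trans
    (mul_le_mul_right (hφ.sobolevNorm_sub_le n m) _)

theorem magneticDeriv (hφ : TendstoH1 φ u) (h : PotentialBounds B δ M) (j : Fin 2) :
    TendstoL2 volume (fun n => magneticDeriv B j (φ n))
      fun x => Complex.I * weakPartial j u x + (vectorPot B x j : ℂ) * u x := by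
  obtain ⟨A, hA⟩ := h.exists_abs_vectorPot_le
  exact ((hφ.tendstoL2_partialC j).smul_of_norm_le (a := fun _ => Complex.I)
    aestronglyMeasurable_const fun _ => Complex.norm_I.le).add
    (hφ.tendstoL2.smul_of_norm_le (a := fun x => (vectorPot B x j : ℂ))
      (Complex.continuous_ofReal.comp (h.continuous_vectorPot j)).aestronglyMeasurable
      fun x => (Complex.norm_real _).trans_le (hA j x))

theorem tendsto_integral_mul_norm_sq (hφ : TendstoH1 φ u) (h : PotentialBounds B δ M) :
    Tendsto (fun n => ∫ x, B x * ‖φ n x‖ ^ 2) atTop (𝓝 (∫ x, B x * ‖u x‖ ^ 2)) := by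
  have hB : AEMeasurable B := h.int.1.aemeasurable
  have hsign : ∀ x, B x / |B x| * |B x| = B x := fun x => div_mul_cancel_of_imp abs_eq_zero.1
  simpa only [norm_sqrt_abs_smul_sq, ← mul_assoc, hsign] using
    (hφ.sqrt_abs_smul h).tendsto_integral_mul_norm_sq (a := fun x => B x / |B x|) (A := 1)
      (hB.div hB.norm).aestronglyMeasurable fun x => by
        rw [norm_div, norm_eq_abs, norm_eq_abs, abs_abs]
        exact div_self_le_one _

end TendstoH1

namespace PotentialBounds

theorem integrable_mul_norm_sq_of_memH1 (h : PotentialBounds B δ M) (hu : MemH1 u) :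
    Integrable fun x => B x * ‖u x‖ ^ 2 := by
  obtain ⟨φ, hφ⟩ := exists_tendstoH1 hu
  have hmem := (hφ.sqrt_abs_smul h).memLp_limit
  refine ((memLp_two_iff_integrable_sq_norm hmem.1).1 hmem).mono (h.int.1.mul (hu.1.1.norm.pow 2))
    (Eventually.of_forall fun x => ?_)
  simp only [norm_sqrt_abs_smul_sq, norm_mul, norm_eq_abs, abs_abs, le_refl]

theorem integrable_norm_sq_magnetic (h : PotentialBounds B δ M) (hu : MemH1 u) (j : Fin 2) :
    Integrable fun x =>
      ‖Complex.I * weakPartial j u x + (vectorPot B x j : ℂ) * u x‖ ^ 2 := by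
  obtain ⟨φ, hφ⟩ := exists_tendstoH1 hu
  have hmem := (hφ.magneticDeriv h j).memLp_limit
  exact (memLp_two_iff_integrable_sq_norm hmem.1).1 hmem

theorem integrable_densityMinus (h : PotentialBounds B δ M) (hu : MemH1 u) :
    Integrable (densityMinus B u) :=
  (integrable_finsetSum _ fun j _ => h.integrable_norm_sq_magnetic hu j).sub
    (h.integrable_mul_norm_sq_of_memH1 hu)

theorem tendsto_integral_norm_sq_spinDeriv (h : PotentialBounds B δ M) {φ : ℕ → Plane → ℂ}
    (hφ : TendstoH1 φ u) :
    Tendsto (fun n => ∫ x, ‖spinDeriv B (φ n) x‖ ^ 2) atTop (𝓝 (formMinus B u)) := by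
  have hmag := h.integrable_norm_sq_magnetic hφ.memH1
  have hform : formMinus B u = (∑ j, ∫ x,
      ‖Complex.I * weakPartial j u x + (vectorPot B x j : ℂ) * u x‖ ^ 2)
        - ∫ x, B x * ‖u x‖ ^ 2 := by
    rw [← integral_finsetSum _ fun j _ => hmag j,
      ← integral_sub (integrable_finsetSum _ fun j _ => hmag j)
        (h.integrable_mul_norm_sq_of_memH1 hφ.memH1)]
    rfl
  simp only [fun n => h.integral_norm_sq_spinDeriv (hφ.isTestFunction n), hform]
  exact (tendsto_finsetSum _ fun j _ => (hφ.magneticDeriv h j).tendsto_integral_norm_sq).sub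
    (hφ.tendsto_integral_mul_norm_sq h)

theorem hardy_formMinus (h : PotentialBounds B δ M) (hρ : 0 < ρ)
    (hw : IsHardyWeight (flux B) ρ C w) (hu : MemH1 u) :
    betaMinus B ρ * C * ∫ x, w ‖x‖ * ‖u x‖ ^ 2 ≤ formMinus B u := by
  obtain ⟨φ, hφ⟩ := exists_tendstoH1 hu
  obtain ⟨A, hA⟩ := hw.bounded
  have hlim := hφ.tendstoL2.tendsto_integral_mul_norm_sq (a := fun x => w ‖x‖) (A := A)
    (hw.continuous.comp continuous_norm).aestronglyMeasurable fun x => by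
      rw [norm_of_nonneg (hw.nonneg _)]
      exact hA _
  exact le_of_tendsto_of_tendsto' (hlim.const_mul _) (h.tendsto_integral_norm_sq_spinDeriv hφ)
    fun n => h.hardy_testFunction hρ hw (hφ.isTestFunction n)

end PotentialBounds

end FormDomain

end PauliHardy

end

theorem theorem2p5_general (B : PauliHardy.Plane → ℝ) {q s : ℝ} (hq : 2 < q) (hs : 0 < s)
    (hB : MeasureTheory.MemLp B (ENNReal.ofReal q)) (hint : MeasureTheory.Integrable B)
    (hmom : MeasureTheory.Integrable fun y => |B y| * ‖y‖ ^ s)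
    (hα : PauliHardy.flux B ≤ 0) (u : PauliHardy.Plane → ℂ) (hu : PauliHardy.MemH1 u)
    (ρ : ℝ) (hρ : 0 < ρ) :
    MeasureTheory.Integrable (PauliHardy.densityMinus B u) ∧
    ((¬ ∃ n : ℤ, (n : ℝ) = PauliHardy.flux B) →
      MeasureTheory.Integrable (fun x : PauliHardy.Plane => ‖u x‖ ^ 2 / (ρ ^ 2 + ‖x‖ ^ 2)) ∧
      PauliHardy.betaMinus B ρ * PauliHardy.distInt (PauliHardy.flux B) ^ 2 *
          ∫ x : PauliHardy.Plane, ‖u x‖ ^ 2 / (ρ ^ 2 + ‖x‖ ^ 2)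
        ≤ PauliHardy.formMinus B u) ∧
    ((∃ n : ℤ, (n : ℝ) = PauliHardy.flux B) →
      MeasureTheory.Integrable (fun x : PauliHardy.Plane =>
        ‖u x‖ ^ 2 / (ρ ^ 2 + ‖x‖ ^ 2 * (1 + Real.log (‖x‖ / ρ) ^ 2))) ∧
      PauliHardy.betaMinus B ρ *
          (|PauliHardy.flux B| / (4 * |PauliHardy.flux B| + Real.pi)) *
          ∫ x : PauliHardy.Plane,
            ‖u x‖ ^ 2 / (ρ ^ 2 + ‖x‖ ^ 2 * (1 + Real.log (‖x‖ / ρ) ^ 2))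
        ≤ PauliHardy.formMinus B u) := by
  obtain ⟨δ, M, h⟩ := PauliHardy.exists_potentialBounds hq hs hint hB hmom
  simp only [div_eq_inv_mul (_ ^ 2 : ℝ) (_ + _)]
  refine ⟨h.integrable_densityMinus hu, fun _ => ?_, fun hflux => ?_⟩
  · have hw := PauliHardy.isHardyWeight_inv_sq hα hρ
    exact ⟨hw.integrable_mul_norm_sq hu.1, h.hardy_formMinus hρ hw hu⟩
  · have hw := PauliHardy.isHardyWeight_logWeight hα hflux hρ
    exact ⟨hw.integrable_mul_norm_sq hu.1, h.hardy_formMinus hρ hw hu⟩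

theorem theorem2p5 (B : PauliHardy.Plane → ℝ) (hB : PauliHardy.AdmissibleField B)
    (hα : PauliHardy.flux B ≤ 0) (u : PauliHardy.Plane → ℂ) (hu : PauliHardy.MemH1 u)
    (ρ : ℝ) (hρ : 0 < ρ) :
    MeasureTheory.Integrable (PauliHardy.densityMinus B u) ∧
    ((¬ ∃ n : ℤ, (n : ℝ) = PauliHardy.flux B) →
      MeasureTheory.Integrable (fun x : PauliHardy.Plane => ‖u x‖ ^ 2 / (ρ ^ 2 + ‖x‖ ^ 2)) ∧
      PauliHardy.betaMinus B ρ * PauliHardy.distInt (PauliHardy.flux B) ^ 2 *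
          ∫ x : PauliHardy.Plane, ‖u x‖ ^ 2 / (ρ ^ 2 + ‖x‖ ^ 2)
        ≤ PauliHardy.formMinus B u) ∧
    ((∃ n : ℤ, (n : ℝ) = PauliHardy.flux B) →
      MeasureTheory.Integrable (fun x : PauliHardy.Plane =>
        ‖u x‖ ^ 2 / (ρ ^ 2 + ‖x‖ ^ 2 * (1 + Real.log (‖x‖ / ρ) ^ 2))) ∧
      PauliHardy.betaMinus B ρ *
          (|PauliHardy.flux B| / (4 * |PauliHardy.flux B| + Real.pi)) *
          ∫ x : PauliHardy.Plane,
            ‖u x‖ ^ 2 / (ρ ^ 2 + ‖x‖ ^ 2 * (1 + Real.log (‖x‖ / ρ) ^ 2))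
        ≤ PauliHardy.formMinus B u) := by
  obtain ⟨q, hq, hBq⟩ := hB.exists_memLp
  obtain ⟨hint, s, hs, hmom⟩ := hB.exists_integrable_moment
  exact theorem2p5_general B hq hs hBq hint hmom hα u hu ρ hρ
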